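/- **Lemma 4.1.** Let $n\ge 1$, $\alpha>0$, and let $\mathbb S^n\subset\mathbb R^{n+1}$ be the unit sphere with its standard surface measure $d\sigma$. Let $X:\mathbb S^n\times[0,T)\to\mathbb R^{n+1}$ be a strictly convex and smooth solution of the $\alpha$-Gauss curvature flow. This means that $X$ is smooth on $\mathbb S^n\times[0,T)$, that for every $t\in[0,T)$ the map $X(\cdot,t)$ is a smooth embedding whose image $\Sigma_t=X(\mathbb S^n,t)$ is the boundary of a convex body (its convex hull) and has positive definite second fundamental form $h_{ij}=-\langle\partial_i\partial_jX,\nu\rangle$, and that $$\frac{\partial X}{\partial t}(x,t)=-K^\alpha(x,t)\,\nu(x,t)\qquad (x\in\mathbb S^n,\ t\in[0,T)),$$ where $\nu(\cdot,t)$ is the outward unit normal of $\Sigma_t$ and $K=\det(g^{ik}h_{kj})$ with $g_{ij}=\langle\partial_iX,\partial_jX\rangle$ is the Gauss curvature of $\Sigma_t$ (at $t=0$ the time derivative is one-sided). Then for every $t\in[0,T)$ the Gauss map $\nu(\cdot,t):\mathbb S^n\to\mathbb S^n$ is bijective, so that one may put $K(z,t)=K(\nu^{-1}(z),t)$ and $S(z,t)=\langle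 z,X(\nu^{-1}(z),t)\rangle$ for $z\in\mathbb S^n$. The volume $V(t)$ (Lebesgue measure) of the convex body enclosed by $\Sigma_t$ is given by $$V(t)=\frac1{n+1}\int_{\Sigma_t}\langle X,\nu\rangle\,d\sigma_{\Sigma_t}=\frac1{n+1}\int_{\mathbb S^n}\frac{S(z,t)}{K(z,t)}\,d\sigma(z),$$ and $V$ is differentiable on $[0,T)$ (one-sidedly at $t=0$) with $$\frac{dV}{dt}(t)=-\int_{\mathbb S^n}K(z,t)^{\alpha-1}\,d\sigma(z).$$ -/

import Mathlib

open Set MeasureTheory Manifold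
open scoped ContDiff RealInnerProductSpace

namespace GaussFlow

/-- The ambient Euclidean space `ℝⁿ⁺¹`. -/
abbrev Space (n : ℕ) : Type := EuclideanSpace ℝ (Fin (n + 1))

/-- The unit sphere `𝕊ⁿ ⊂ ℝⁿ⁺¹`, with Mathlib's manifold structure. -/
abbrev USphere (n : ℕ) : Type := Metric.sphere (0 : EuclideanSpace ℝ (Fin (n + 1))) 1

variable {n : ℕ}

/-- The standard surface measure `dσ` of the unit sphere. -/
noncomputable def sphereMeasure (n : ℕ) : Measure (USphere n) :=
  (volume : Measure (Space n)).toSphere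

/-- The map `Y : 𝕊ⁿ → ℝⁿ⁺¹` written in the chart of `𝕊ⁿ` around `x`. -/
noncomputable def inChart (Y : USphere n → Space n) (x : USphere n) :
    EuclideanSpace ℝ (Fin n) → Space n :=
  Y ∘ (extChartAt (𝓡 n) x).symm

/-- The partial derivative `∂Y/∂xⁱ` in the chart around `x`, as a function of the coordinates. -/
noncomputable def partialDeriv (Y : USphere n → Space n) (x : USphere n) (i : Fin n) :
    EuclideanSpace ℝ (Fin n) → Space n :=
  fun u => fderiv ℝ (inChart Y x) u (EuclideanSpace.single i 1)

/-- The second partial derivative `∂²Y/∂xⁱ∂xʲ` in the chart around `x`, as a function of the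
coordinates. -/
noncomputable def partialDeriv₂ (Y : USphere n → Space n) (x : USphere n) (i j : Fin n) :
    EuclideanSpace ℝ (Fin n) → Space n :=
  fun u => fderiv ℝ (partialDeriv Y x j) u (EuclideanSpace.single i 1)

/-- The induced metric `g_ij = ⟨∂Y/∂xⁱ, ∂Y/∂xʲ⟩` at `x`. -/
noncomputable def metricForm (Y : USphere n → Space n) (x : USphere n) :
    Matrix (Fin n) (Fin n) ℝ :=
  Matrix.of fun i j =>
    ⟪partialDeriv Y x i (extChartAt (𝓡 n) x x), partialDeriv Y x j (extChartAt (𝓡 n) x x)⟫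

/-- The second fundamental form `h_ij = -⟨∂²Y/∂xⁱ∂xʲ, ν⟩` at `x`, for the unit normal field `ν`. -/
noncomputable def secondForm (Y : USphere n → Space n) (ν : USphere n → USphere n)
    (x : USphere n) : Matrix (Fin n) (Fin n) ℝ :=
  Matrix.of fun i j => -⟪partialDeriv₂ Y x i j (extChartAt (𝓡 n) x x), (ν x : Space n)⟫

/-- The Gauss curvature `K = det (gⁱᵏ h_kj)` at the parameter `x`. It does not depend on the
chart. -/
noncomputable def gaussCurvature (Y : USphere n → Space n) (ν : USphere n → USphere n)
    (x : USphere n) : ℝ :=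
  ((metricForm Y x)⁻¹ * secondForm Y ν x).det

/-- The density of the surface measure of the hypersurface `Y`, pulled back to `𝕊ⁿ`, with respect
to the standard measure of `𝕊ⁿ`, that is `√(det g_ij) / √(det ḡ_ij)` where `ḡ` is the standard
metric of `𝕊ⁿ` (the metric induced by the inclusion). It does not depend on the chart. -/
noncomputable def areaDensity (Y : USphere n → Space n) (x : USphere n) : ℝ :=
  √((metricForm Y x).det) / √((metricForm (fun y : USphere n => (y : Space n)) x).det)

/-- The convex body enclosed by the convex hypersurface `Y(𝕊ⁿ)`. -/
def enclosedBody (Y : USphere n → Space n) : Set (Space n) :=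
  convexHull ℝ (range Y)

/-- The enclosed volume: the Lebesgue measure of the enclosed convex body. -/
noncomputable def enclosedVolume (Y : USphere n → Space n) : ℝ :=
  volume.real (enclosedBody Y)

/-- `Y` is a smooth embedding of the (compact) sphere: a smooth injective immersion. -/
structure IsSmoothEmbedding (Y : USphere n → Space n) : Prop where
  smooth : ContMDiff (𝓡 n) 𝓘(ℝ, Space n) ∞ Y
  injective : Function.Injective Y
  immersion : ∀ x, Function.Injective (mvfderiv (𝓡 n) Y x)

/-- `ν` is the outward unit normal of the convex hypersurface `Y(𝕊ⁿ)`: `ν x` is a unit vector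
(an element of `𝕊ⁿ`) orthogonal to the tangent space at `Y x`, and it points away from the
enclosed body. -/
structure IsOutwardNormal (Y : USphere n → Space n) (ν : USphere n → USphere n) : Prop where
  normal : ∀ x (v : TangentSpace (𝓡 n) x), ⟪mvfderiv (𝓡 n) Y x v, (ν x : Space n)⟫ = 0
  outward : ∀ x, ∀ p ∈ enclosedBody Y, ⟪p - Y x, (ν x : Space n)⟫ ≤ 0

/-- `Y(𝕊ⁿ)` is a smooth strictly convex hypersurface with outward unit normal `ν`: it is smoothly
embedded, it is the boundary of a convex body, and its second fundamental form is positive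
definite, that is, all principal curvatures are positive. -/
structure IsStrictlyConvex (Y : USphere n → Space n) (ν : USphere n → USphere n) : Prop where
  embedding : IsSmoothEmbedding Y
  boundary : frontier (enclosedBody Y) = range Y
  outwardNormal : IsOutwardNormal Y ν
  posDef : ∀ x, (secondForm Y ν x).PosDef

/-- `X : [0, T) × 𝕊ⁿ → ℝⁿ⁺¹`, with outward unit normals `ν t`, is a strictly convex and smooth
solution of the `α`-Gauss curvature flow `∂X/∂t = -K^α ν`. -/
structure IsSolution (α T : ℝ) (X : ℝ → USphere n → Space n)
    (ν : ℝ → USphere n → USphere n) : Prop where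
  smooth : ContMDiffOn ((𝓡 n).prod 𝓘(ℝ, ℝ)) 𝓘(ℝ, Space n) ∞
    (fun p : USphere n × ℝ => X p.2 p.1) (univ ×ˢ Ico 0 T)
  strictlyConvex : ∀ t ∈ Ico 0 T, IsStrictlyConvex (X t) (ν t)
  flow : ∀ t ∈ Ico 0 T, ∀ x, HasDerivWithinAt (fun s => X s x)
    (-(gaussCurvature (X t) (ν t) x ^ α) • (ν t x : Space n)) (Ico 0 T) t

/-- The inverse `ν⁻¹` of the Gauss map (a genuine inverse when `ν` is bijective). -/
noncomputable def gaussInv (ν : USphere n → USphere n) (z : USphere n) : USphere n :=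
  haveI : Nonempty (USphere n) := ⟨z⟩
  Function.invFun ν z

/-- The support function `S(z) = ⟨z, Y(ν⁻¹(z))⟩`. -/
noncomputable def supportFunction (Y : USphere n → Space n) (ν : USphere n → USphere n)
    (z : USphere n) : ℝ :=
  ⟪(z : Space n), Y (gaussInv ν z)⟫

/-- The Gauss curvature `K(z) = K(ν⁻¹(z))` as a function of the outward unit normal `z`. -/
noncomputable def curvatureAtNormal (Y : USphere n → Space n) (ν : USphere n → USphere n)
    (z : USphere n) : ℝ :=
  gaussCurvature Y ν (gaussInv ν z)

end GaussFlow

/-! Every Jacobian is computed in the ambient space. A map on the sphere is extended to be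
homogeneous of degree zero, so that its differential `L` kills `x`; the endomorphism `augment L w x`
then restores a direction `w` along `x` and has a determinant. For `w = ν` its absolute value is the
area density, and the product of two such determinants is a Gram determinant. By the Weingarten
equations, the Gauss map therefore has Jacobian `K` relative to surface area.

The cone map `y ↦ ‖y‖ Z(y/‖y‖)` has derivative `augment (dZ) (Z x) x` along the whole ray through
`x`, so polar coordinates give the volume of a cone over `Z` (`volume_image_coneMap`). With `Z = ν`
this yields the change of variables `dσ = K dA` (`map_normal`); with `Z = Y - c`, `c` interior, it
yields the volume formula based at `c`. That formula is affine in `c` and constant on an open set,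
so `∫ ν dA = 0` and `c` drops out without the divergence theorem.

The Gauss map is onto because a linear functional attains its maximum on the compact hypersurface.
It is injective because equal normals at two points would put a segment into the hypersurface, along
which `ν` is constant, contradicting its local injectivity.

For the evolution, the support function strictly decreases in time, so the bodies are nested and the
hypersurfaces disjoint. The map `r x ↦ X r x` is then injective and sweeps out the region between
two of them, with Jacobian `K ^ α dA dr`. Hence `V(t) - V(s)` is the time integral of `∫ K ^ α dA`,
which is continuous in time, and the fundamental theorem of calculus gives `V'`. Passing to the
normal variable turns `K ^ α dA` into `K ^ (α - 1) dσ`. -/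

namespace GaussFlow

/-! ### Determinants of rank one modifications -/

section LinearAlgebra

variable {E : Type*} [NormedAddCommGroup E] [InnerProductSpace ℝ E]

/-- The rank one modification `y ↦ L y + ⟪x, y⟫ w` of `L`. -/
noncomputable def augment (L : E →L[ℝ] E) (w x : E) : E →L[ℝ] E :=
  L + (innerSL ℝ x).smulRight w

@[simp]
theorem augment_apply (L : E →L[ℝ] E) (w x y : E) : augment L w x y = L y + ⟪x, y⟫ • w := rfl

theorem continuous_augment :
    Continuous fun p : (E →L[ℝ] E) × E × E => augment p.1 p.2.1 p.2.2 := by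
  unfold augment
  fun_prop

variable [FiniteDimensional ℝ E]

theorem det_id_add_smulRight (x a : E) :
    (ContinuousLinearMap.id ℝ E + (innerSL ℝ x).smulRight a).det = 1 + ⟪x, a⟫ := by
  have h := LinearMap.transvection.det (innerSL ℝ x : E →ₗ[ℝ] ℝ) a
  exact h

/-- The two maps differ by a factor that scales `x^⊥` by `r⁻¹` and fixes `x`. The power `r ^ n` is
the weight of polar coordinates, which this identity absorbs for the sweep map. -/
theorem det_augment_smul {L : E →L[ℝ] E} {x : E} (hx : ‖x‖ = 1) (hLx : L x = 0) (w : E)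
    {r : ℝ} (hr : r ≠ 0) {n : ℕ} (hn : Module.finrank ℝ E = n + 1) :
    (augment (r⁻¹ • L) w x).det * r ^ n = (augment L w x).det := by
  have hxx : ⟪x, x⟫ = 1 := by rw [real_inner_self_eq_norm_sq, hx]; norm_num
  have h : augment (r⁻¹ • L) w x = augment L w x ∘L
      (r⁻¹ • (ContinuousLinearMap.id ℝ E + (innerSL ℝ x).smulRight ((r - 1) • x))) := by
    ext1 y
    have hy : (r⁻¹ • (ContinuousLinearMap.id ℝ E + (innerSL ℝ x).smulRight ((r - 1) • x))) y
        = r⁻¹ • (y + ⟪x, y⟫ • (r - 1) • x) := rfl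
    rw [ContinuousLinearMap.comp_apply, hy, augment_apply, augment_apply, map_smul, map_add,
      map_smul, map_smul, hLx, smul_zero, smul_zero, add_zero, inner_smul_right, inner_add_right,
      inner_smul_right, inner_smul_right, hxx]
    have : r⁻¹ * (⟪x, y⟫ + ⟪x, y⟫ * ((r - 1) * 1)) = ⟪x, y⟫ := by field_simp; ring
    rw [this]
    rfl
  have hd : (r⁻¹ • (ContinuousLinearMap.id ℝ E
      + (innerSL ℝ x).smulRight ((r - 1) • x))).det = r⁻¹ ^ (n + 1) * r := by
    have := det_id_add_smulRight x ((r - 1) • x)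
    rw [inner_smul_right, hxx] at this
    rw [ContinuousLinearMap.det, ContinuousLinearMap.toLinearMap_smul, LinearMap.det_smul, hn]
    rw [ContinuousLinearMap.det] at this
    rw [this]
    ring
  have hc : (augment (r⁻¹ • L) w x).det = (augment L w x).det * (r⁻¹ ^ (n + 1) * r) := by
    rw [h, ← hd]
    exact LinearMap.det_comp _ _
  rw [hc, pow_succ, mul_assoc _ (r⁻¹), inv_mul_cancel₀ hr, mul_one, mul_assoc, ← mul_pow,
    inv_mul_cancel₀ hr, one_pow, mul_one]

/-- The tangential part of `w` lies in the range of `L` and does not affect the determinant: with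
`a` a preimage of `w` under `augment L ν x`, the two maps differ by a transvection-like factor of
determinant `⟪x, a⟫ = ⟪w, ν⟫`. -/
theorem det_augment_eq_inner_mul {L : E →L[ℝ] E} {x ν : E} (hx : ‖x‖ = 1) (hν : ‖ν‖ = 1)
    (hLx : L x = 0) (hLν : ∀ y, ⟪L y, ν⟫ = 0) (hL : ∀ y, ⟪x, y⟫ = 0 → L y = 0 → y = 0) (w : E) :
    (augment L w x).det = ⟪w, ν⟫ * (augment L ν x).det := by
  have hxx : ⟪x, x⟫ = 1 := by rw [real_inner_self_eq_norm_sq, hx]; norm_num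
  have hνν : ⟪ν, ν⟫ = 1 := by rw [real_inner_self_eq_norm_sq, hν]; norm_num
  have hinj : Function.Injective (augment L ν x : E →ₗ[ℝ] E) := by
    refine (injective_iff_map_eq_zero _).2 fun y hy => ?_
    have hy' : L y + ⟪x, y⟫ • ν = 0 := hy
    have h0 : ⟪x, y⟫ = 0 := by
      have := congrArg (fun u => ⟪u, ν⟫) hy'
      rwa [inner_add_left, inner_smul_left, hLν, hνν, zero_add, mul_one, inner_zero_left] at this
    refine hL y h0 ?_
    simpa [h0] using hy'
  obtain ⟨a, ha⟩ := LinearMap.injective_iff_surjective.1 hinj w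
  have ha' : L a + ⟪x, a⟫ • ν = w := ha
  have hwa : ⟪w, ν⟫ = ⟪x, a⟫ := by
    rw [← ha', inner_add_left, hLν, inner_smul_left, hνν]; simp
  have h : augment L w x = augment L ν x ∘L
      (ContinuousLinearMap.id ℝ E + (innerSL ℝ x).smulRight (a - x)) := by
    ext1 y
    have hy : (ContinuousLinearMap.id ℝ E + (innerSL ℝ x).smulRight (a - x)) y
        = y + ⟪x, y⟫ • (a - x) := rfl
    rw [ContinuousLinearMap.comp_apply, hy, augment_apply, augment_apply, map_add, map_smul,
      map_sub, hLx, inner_add_right, inner_smul_right, inner_sub_right, hxx, ← ha']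
    module
  have hc : (augment L w x).det = (augment L ν x).det * (1 + ⟪x, a - x⟫) := by
    rw [h, ← det_id_add_smulRight]
    exact LinearMap.det_comp _ _
  rw [hc, inner_sub_right, hxx, hwa]
  ring

/-- The product is the determinant of `P* Q`, which in the orthonormal basis `(e, x)` is block
diagonal: the Gram block of `L`, `L'`, and a `1` from `ν`. -/
theorem det_augment_mul_det_augment {n : ℕ} (hn : Module.finrank ℝ E = n + 1)
    {L L' : E →L[ℝ] E} {x ν : E} (hx : ‖x‖ = 1) (hν : ‖ν‖ = 1)
    (hLx : L x = 0) (hLx' : L' x = 0) (hLν : ∀ y, ⟪L y, ν⟫ = 0) (hLν' : ∀ y, ⟪L' y, ν⟫ = 0)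
    {e : Fin n → E} (he : Orthonormal ℝ e) (hex : ∀ i, ⟪x, e i⟫ = 0) :
    (augment L ν x).det * (augment L' ν x).det
      = (Matrix.of fun i j => ⟪L (e i), L' (e j)⟫).det := by
  let v : Fin n ⊕ Unit → E := Sum.elim e (fun _ => x)
  have hv : Orthonormal ℝ v := by
    rw [orthonormal_iff_ite] at he ⊢
    rintro (i | i) (j | j)
    · simpa [v] using he i j
    · simpa [v, real_inner_comm] using hex i
    · simpa [v] using hex j
    · simp [v, hx]
  have : Nonempty (Fin n ⊕ Unit) := ⟨Sum.inr ()⟩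
  let b : OrthonormalBasis (Fin n ⊕ Unit) ℝ E :=
    OrthonormalBasis.mk hv (by
      have := (hv.linearIndependent.span_eq_top_of_card_eq_finrank (by simp [hn]))
      exact this.ge)
  have hb : ∀ i, b i = v i := fun i => by simp [b]
  set P := augment L ν x
  set Q := augment L' ν x
  have h1 : P.det * Q.det = (LinearMap.adjoint (P : E →ₗ[ℝ] E) ∘ₗ (Q : E →ₗ[ℝ] E)).det := by
    rw [LinearMap.det_comp, ← LinearMap.det_toMatrix b.toBasis (LinearMap.adjoint _),
      LinearMap.toMatrix_adjoint, Matrix.det_conjTranspose, LinearMap.det_toMatrix]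
    rfl
  rw [h1, ← LinearMap.det_toMatrix b.toBasis]
  have h2 : LinearMap.toMatrix b.toBasis b.toBasis
      (LinearMap.adjoint (P : E →ₗ[ℝ] E) ∘ₗ (Q : E →ₗ[ℝ] E))
      = Matrix.fromBlocks (Matrix.of fun i j => ⟪L (e i), L' (e j)⟫) 0 0 1 := by
    have key : ∀ i j, LinearMap.toMatrix b.toBasis b.toBasis
      (LinearMap.adjoint (P : E →ₗ[ℝ] E) ∘ₗ (Q : E →ₗ[ℝ] E)) i j = ⟪P (v i), Q (v j)⟫ := by
      intro i j
      rw [LinearMap.toMatrix_apply, OrthonormalBasis.coe_toBasis_repr_apply,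
        OrthonormalBasis.repr_apply_apply, OrthonormalBasis.coe_toBasis, LinearMap.comp_apply,
        LinearMap.adjoint_inner_right, hb, hb]
      rfl
    have hLνr : ∀ y, ⟪ν, L' y⟫ = 0 := fun y => by rw [real_inner_comm]; exact hLν' y
    ext (i | i) (j | j)
    · rw [key]; simp [v, P, Q, hex]
    · rw [key]; simp [v, P, Q, hex, hx, hLx', hLν]
    · rw [key]; simp [v, P, Q, hex, hx, hLx, hLνr]
    · rw [key]; simp [v, P, Q, hx, hLx, hLx', hν]
  rw [h2, Matrix.det_fromBlocks_zero₁₂]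
  simp

end LinearAlgebra

variable {n : ℕ}

/-! ### Polar coordinates -/

section Polar

open scoped ENNReal

theorem finrank_space (n : ℕ) : Module.finrank ℝ (Space n) = n + 1 := finrank_euclideanSpace_fin

instance : IsFiniteMeasure (sphereMeasure n) :=
  inferInstanceAs (IsFiniteMeasure (volume : Measure (Space n)).toSphere)

theorem lintegral_eq_lintegral_polar {g : Space n → ℝ≥0∞} (hg : Measurable g) :
    ∫⁻ y, g y = ∫⁻ r in Ioi (0 : ℝ),
      (∫⁻ x : USphere n, g (r • (x : Space n)) ∂(sphereMeasure n)) * ENNReal.ofReal (r ^ n) := by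
  have hmp := (volume : Measure (Space n)).measurePreserving_homeomorphUnitSphereProd
  rw [finrank_space, Nat.add_sub_cancel] at hmp
  have h1 : ∫⁻ y, g y = ∫⁻ y : ({(0 : Space n)}ᶜ : Set (Space n)), g y ∂(volume.comap Subtype.val) := by
    rw [lintegral_subtype_comap (measurableSet_singleton _).compl, restrict_compl_singleton]
  have hc : Measurable fun q : USphere n × Ioi (0 : ℝ) => g ((q.2 : ℝ) • (q.1 : Space n)) :=
    hg.comp (by fun_prop)
  have h2 : ∫⁻ y : ({(0 : Space n)}ᶜ : Set (Space n)), g y ∂(volume.comap Subtype.val)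
      = ∫⁻ q, g ((q.2 : ℝ) • (q.1 : Space n))
        ∂((volume : Measure (Space n)).toSphere.prod (Measure.volumeIoiPow n)) := by
    rw [← hmp.lintegral_comp hc]
    refine lintegral_congr fun y => ?_
    congr 1
    have : ‖(y : Space n)‖ ≠ 0 := norm_ne_zero_iff.2 y.2
    simp [smul_smul, this]
  rw [h1, h2, lintegral_prod_symm' _ hc, Measure.volumeIoiPow,
    lintegral_withDensity_eq_lintegral_mul _ (by fun_prop) hc.lintegral_prod_left',
    ← lintegral_subtype_comap measurableSet_Ioi]
  refine lintegral_congr fun r => ?_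
  simp only [Pi.mul_apply]
  rw [mul_comm]
  rfl

theorem setLIntegral_eq_lintegral_polar {g : Space n → ℝ≥0∞} (hg : Measurable g) {I : Set ℝ}
    (hI : MeasurableSet I) (hI0 : I ⊆ Ioi 0) :
    ∫⁻ y in {y | ‖y‖ ∈ I}, g y = ∫⁻ r in I,
      (∫⁻ x : USphere n, g (r • (x : Space n)) ∂(sphereMeasure n)) * ENNReal.ofReal (r ^ n) := by
  have hm : MeasurableSet {y : Space n | ‖y‖ ∈ I} := measurable_norm hI
  rw [← lintegral_indicator hm, lintegral_eq_lintegral_polar (hg.indicator hm)]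
  have : ∀ r ∈ Ioi (0 : ℝ), (∫⁻ x : USphere n, ({y : Space n | ‖y‖ ∈ I}.indicator g)
      (r • (x : Space n)) ∂(sphereMeasure n)) * ENNReal.ofReal (r ^ n)
      = I.indicator (fun r => (∫⁻ x : USphere n, g (r • (x : Space n)) ∂(sphereMeasure n))
        * ENNReal.ofReal (r ^ n)) r := by
    intro r hr
    have hn : ∀ x : USphere n, ‖r • (x : Space n)‖ = r := fun x => by
      rw [norm_smul, norm_eq_of_mem_sphere, mul_one, Real.norm_of_nonneg (le_of_lt hr)]
    by_cases hrI : r ∈ I <;> simp [indicator, hn, hrI]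
  rw [setLIntegral_congr_fun measurableSet_Ioi this, lintegral_indicator hI,
    Measure.restrict_restrict hI, inter_eq_left.2 hI0]

end Polar

/-! ### Radial projection onto the sphere -/

section RadialProjection

/-- The radial projection `y ↦ y / ‖y‖` onto the unit sphere (a fixed point for `y = 0`). -/
noncomputable def radialProj (y : Space n) : USphere n :=
  if h : y = 0 then ⟨EuclideanSpace.single 0 1, by simp⟩
  else ⟨‖y‖⁻¹ • y, by simp [norm_smul, norm_ne_zero_iff.2 h]⟩

theorem coe_radialProj {y : Space n} (h : y ≠ 0) : (radialProj y : Space n) = ‖y‖⁻¹ • y := by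
  simp [radialProj, h]

theorem norm_smul_radialProj (y : Space n) : ‖y‖ • (radialProj y : Space n) = y := by
  rcases eq_or_ne y 0 with rfl | h
  · simp
  · rw [coe_radialProj h, smul_smul, mul_inv_cancel₀ (norm_ne_zero_iff.2 h), one_smul]

theorem radialProj_smul (x : USphere n) {r : ℝ} (hr : 0 < r) :
    radialProj (r • (x : Space n)) = x := by
  have hx : (x : Space n) ≠ 0 := ne_zero_of_mem_unit_sphere x
  apply Subtype.ext
  rw [coe_radialProj (smul_ne_zero hr.ne' hx), norm_smul, norm_eq_of_mem_sphere, mul_one,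
    Real.norm_of_nonneg hr.le, smul_smul, inv_mul_cancel₀ hr.ne', one_smul]

theorem radialProj_coe (x : USphere n) : radialProj (x : Space n) = x := by
  simpa using radialProj_smul x one_pos

theorem radialProj_smul' {y : Space n} (hy : y ≠ 0) {r : ℝ} (hr : 0 < r) :
    radialProj (r • y) = radialProj y := by
  rw [← norm_smul_radialProj y, smul_smul, radialProj_smul _ (by positivity),
    radialProj_smul _ (by positivity)]

theorem measurable_radialProj : Measurable (radialProj : Space n → USphere n) := by
  have h : Measurable fun y : Space n =>
      if y = 0 then EuclideanSpace.single (0 : Fin (n + 1)) (1 : ℝ) else ‖y‖⁻¹ • y :=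
    Measurable.ite (measurableSet_singleton _) measurable_const (by fun_prop)
  refine (MeasurableEmbedding.subtype_coe
    Metric.isClosed_sphere.measurableSet).measurable_comp_iff.1 ?_
  convert h using 2 with y
  by_cases hy : y = 0 <;> simp [radialProj, hy]

theorem contMDiffOn_radialProj :
    ContMDiffOn 𝓘(ℝ, Space n) (𝓡 n) ∞ (radialProj : Space n → USphere n) {0}ᶜ := by
  have := Fact.mk (finrank_space n)
  intro y hy
  apply ContMDiffAt.contMDiffWithinAt
  have hy : y ≠ 0 := hy
  have hne : ∀ᶠ z in nhds y, z ≠ 0 := isOpen_ne.mem_nhds hy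
  have hnorm : ContDiffAt ℝ ∞ (fun z : Space n => ‖z‖⁻¹ • z) y :=
    ((contDiffAt_norm ℝ hy).inv (norm_ne_zero_iff.2 hy)).smul contDiffAt_id
  have heq : (fun z => (radialProj z : Space n)) =ᶠ[nhds y] fun z => ‖z‖⁻¹ • z :=
    hne.mono fun z hz => coe_radialProj hz
  rw [contMDiffAt_iff_target]
  refine ⟨Topology.IsInducing.subtypeVal.continuousAt_iff.2 ((hnorm.continuousAt).congr heq.symm), ?_⟩
  rw [contMDiffAt_iff_contDiffAt]
  set v : USphere n := radialProj y
  let U : _ ≃ₗᵢ[ℝ] _ :=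
    (OrthonormalBasis.fromOrthogonalSpanSingleton n (ne_zero_of_mem_unit_sphere (-v))).repr
  have h1 : ContDiffAt ℝ ∞ (fun z : Space n => U (stereoToFun (-v : Space n) (‖z‖⁻¹ • z))) y := by
    refine U.contDiff.contDiffAt.comp y ?_
    refine ContDiffAt.comp (g := stereoToFun (-v : Space n)) y ?_ hnorm
    -- Smoothness fails only where the inner product with the pole `-v` is `1`; at `v` it is `-1`.
    refine contDiffOn_stereoToFun.contDiffAt ?_
    have hc : Continuous fun z : Space n => innerSL ℝ (-v : Space n) z := by fun_prop
    refine (isOpen_ne.preimage hc).mem_nhds ?_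
    show innerSL ℝ (-v : Space n) (‖y‖⁻¹ • y) ≠ 1
    rw [← coe_radialProj hy]
    simp [v]
    norm_num
  refine h1.congr_of_eventuallyEq ?_
  filter_upwards [heq] with z hz
  show U (stereoToFun (-v : Space n) (radialProj z : Space n)) = _
  rw [hz]

end RadialProjection

/-! ### Ambient differentials and the coordinate frame -/

section Differential

/-- The differential of `Y : 𝕊ⁿ → ℝⁿ⁺¹` at `x`, extended by zero to the normal direction: the
derivative of the extension of `Y` that is homogeneous of degree zero. -/
noncomputable def sphereFDeriv (Y : USphere n → Space n) (x : USphere n) :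
    Space n →L[ℝ] Space n :=
  fderiv ℝ (Y ∘ radialProj) (x : Space n)

theorem contMDiff_coe (m : ℕ∞ω) :
    ContMDiff (𝓡 n) 𝓘(ℝ, Space n) m ((↑) : USphere n → Space n) := by
  have := Fact.mk (finrank_space n)
  exact contMDiff_coe_sphere

theorem contDiffOn_comp_radialProj {Y : USphere n → Space n}
    (hY : ContMDiff (𝓡 n) 𝓘(ℝ, Space n) ∞ Y) : ContDiffOn ℝ ∞ (Y ∘ radialProj) {0}ᶜ :=
  contMDiffOn_iff_contDiffOn.1 (hY.comp_contMDiffOn contMDiffOn_radialProj)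

theorem contDiffAt_comp_radialProj {Y : USphere n → Space n}
    (hY : ContMDiff (𝓡 n) 𝓘(ℝ, Space n) ∞ Y) {y : Space n} (hy : y ≠ 0) :
    ContDiffAt ℝ ∞ (Y ∘ radialProj) y :=
  (contDiffOn_comp_radialProj hY).contDiffAt (isOpen_ne.mem_nhds hy)

theorem coe_ne_zero (x : USphere n) : (x : Space n) ≠ 0 := ne_zero_of_mem_unit_sphere x

theorem norm_coe (x : USphere n) : ‖(x : Space n)‖ = 1 := norm_eq_of_mem_sphere x

theorem inner_coe_self (x : USphere n) : ⟪(x : Space n), (x : Space n)⟫ = 1 := by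
  rw [real_inner_self_eq_norm_sq, norm_coe]; norm_num

theorem sphereFDeriv_self {Y : USphere n → Space n} {x : USphere n}
    (hY : DifferentiableAt ℝ (Y ∘ radialProj) (x : Space n)) :
    sphereFDeriv Y x (x : Space n) = 0 := by
  have hline : HasDerivAt (fun r : ℝ => r • (x : Space n)) (x : Space n) 1 := by
    simpa using (hasDerivAt_id (1 : ℝ)).smul_const (x : Space n)
  have h1 : HasDerivAt (fun r : ℝ => (Y ∘ radialProj) (r • (x : Space n)))
      (sphereFDeriv Y x (x : Space n)) 1 := by
    have hd : HasFDerivAt (Y ∘ radialProj) (sphereFDeriv Y x) ((1 : ℝ) • (x : Space n)) := by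
      rw [one_smul]
      exact hY.hasFDerivAt
    exact hd.comp_hasDerivAt (1 : ℝ) hline
  have h2 : HasDerivAt (fun r : ℝ => (Y ∘ radialProj) (r • (x : Space n))) 0 1 := by
    refine (hasDerivAt_const (1 : ℝ) (Y x)).congr_of_eventuallyEq ?_
    filter_upwards [lt_mem_nhds (zero_lt_one' ℝ)] with r hr
    simp [radialProj_smul x hr]
  exact h1.unique h2

theorem hasFDerivAt_comp_radialProj {Y : USphere n → Space n} {x : USphere n}
    (hY : DifferentiableAt ℝ (Y ∘ radialProj) (x : Space n)) {r : ℝ} (hr : 0 < r) :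
    HasFDerivAt (Y ∘ radialProj) (r⁻¹ • sphereFDeriv Y x) (r • (x : Space n)) := by
  have h1 : HasFDerivAt (fun y : Space n => (Y ∘ radialProj) (r⁻¹ • y))
      (r⁻¹ • sphereFDeriv Y x) (r • (x : Space n)) := by
    have hs : HasFDerivAt (fun y : Space n => r⁻¹ • y) (r⁻¹ • ContinuousLinearMap.id ℝ (Space n))
        (r • (x : Space n)) :=
      (hasFDerivAt_id (r • (x : Space n))).const_smul r⁻¹
    have hd : HasFDerivAt (Y ∘ radialProj) (sphereFDeriv Y x) (r⁻¹ • r • (x : Space n)) := by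
      rw [smul_smul, inv_mul_cancel₀ hr.ne', one_smul]
      exact hY.hasFDerivAt
    have h := hd.comp (r • (x : Space n)) hs
    rw [ContinuousLinearMap.comp_smul, ContinuousLinearMap.comp_id] at h
    exact h
  refine h1.congr_of_eventuallyEq ?_
  filter_upwards [isOpen_ne.mem_nhds (smul_ne_zero hr.ne' (coe_ne_zero x))] with y hy
  simp only [Function.comp_apply]
  rw [radialProj_smul' hy (inv_pos.2 hr)]

theorem inChart_eq (Y : USphere n → Space n) (x : USphere n) :
    inChart Y x = (Y ∘ radialProj) ∘ inChart (↑) x := by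
  funext u
  simp [inChart, radialProj_coe]

/-- The coordinate frame at the centre of the chart around `x`. -/
noncomputable def frame (x : USphere n) (i : Fin n) : Space n :=
  partialDeriv (↑) x i (extChartAt (𝓡 n) x x)

/-- The chart at `x` is stereographic projection from `-x`, whose inverse has the inclusion of `x^⊥`
as derivative at the centre `0`. So the coordinate frame there is orthonormal, and the denominator
in `areaDensity` is `1`. -/
theorem exists_hasFDerivAt_inChart_coe (x : USphere n) :
    ∃ J : EuclideanSpace ℝ (Fin n) →ₗᵢ[ℝ] Space n,
      HasFDerivAt (inChart (↑) x) J.toContinuousLinearMap (extChartAt (𝓡 n) x x) ∧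
      ∀ u, ⟪(x : Space n), J u⟫ = 0 := by
  have := Fact.mk (finrank_space n)
  let b := OrthonormalBasis.fromOrthogonalSpanSingleton (𝕜 := ℝ) n
    (ne_zero_of_mem_unit_sphere (-x))
  let U := b.repr
  let V := (ℝ ∙ ((-x : USphere n) : Space n))ᗮ
  have h0 : extChartAt (𝓡 n) x x = 0 := by
    show U (stereographic (norm_eq_of_mem_sphere (-x)) x) = 0
    rw [stereographic_neg_apply, map_zero]
  refine ⟨V.subtypeₗᵢ.comp U.symm.toLinearIsometry, ?_, ?_⟩
  · rw [h0]
    have h1 : HasFDerivAt (stereoInvFunAux ((-x : USphere n) : Space n) ∘ ((↑) : V → Space n))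
        V.subtypeL (U.symm 0) := by
      rw [map_zero]
      exact hasFDerivAt_stereoInvFunAux_comp_coe _
    exact h1.comp 0 U.symm.toContinuousLinearEquiv.hasFDerivAt
  · intro u
    have h : ⟪-(x : Space n), U.symm u⟫ = 0 :=
      (Submodule.mem_orthogonal_singleton_iff_inner_right).1 (U.symm u).2
    rw [inner_neg_left, neg_eq_zero] at h
    exact h

theorem orthonormal_frame (x : USphere n) : Orthonormal ℝ (frame x) := by
  obtain ⟨J, hJ, -⟩ := exists_hasFDerivAt_inChart_coe x
  have : frame x = J ∘ fun i => EuclideanSpace.single i 1 := by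
    funext i
    rw [frame, partialDeriv, hJ.fderiv]
    rfl
  rw [this]
  exact (EuclideanSpace.orthonormal_single (𝕜 := ℝ)).comp_linearIsometry J

theorem inner_frame (x : USphere n) (i : Fin n) : ⟪(x : Space n), frame x i⟫ = 0 := by
  obtain ⟨J, hJ, h⟩ := exists_hasFDerivAt_inChart_coe x
  rw [frame, partialDeriv, hJ.fderiv]
  exact h _

theorem contDiff_inChart_coe (x : USphere n) :
    ContDiff ℝ ∞ (inChart ((↑) : USphere n → Space n) x) := by
  have := Fact.mk (finrank_space n)
  let U := (OrthonormalBasis.fromOrthogonalSpanSingleton (𝕜 := ℝ) n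
    (ne_zero_of_mem_unit_sphere (-x))).repr
  exact (contDiff_stereoInvFunAux.comp
    (ℝ ∙ ((-x : USphere n) : Space n))ᗮ.subtypeL.contDiff).comp U.symm.contDiff

theorem inChart_coe_ne_zero (x : USphere n) (u : EuclideanSpace ℝ (Fin n)) :
    inChart ((↑) : USphere n → Space n) x u ≠ 0 := coe_ne_zero _

theorem inChart_coe_center (x : USphere n) :
    inChart ((↑) : USphere n → Space n) x (extChartAt (𝓡 n) x x) = x := by
  simp [inChart]

theorem partialDeriv_eq {Y : USphere n → Space n} (x : USphere n) (i : Fin n)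
    {u : EuclideanSpace ℝ (Fin n)} (hY : DifferentiableAt ℝ (Y ∘ radialProj) (inChart (↑) x u)) :
    partialDeriv Y x i u =
      fderiv ℝ (Y ∘ radialProj) (inChart (↑) x u) (partialDeriv (↑) x i u) := by
  rw [partialDeriv, inChart_eq, fderiv_comp u hY
    ((contDiff_inChart_coe x).differentiable (by simp) u)]
  rfl

theorem partialDeriv_center {Y : USphere n → Space n} (x : USphere n) (i : Fin n)
    (hY : DifferentiableAt ℝ (Y ∘ radialProj) (x : Space n)) :
    partialDeriv Y x i (extChartAt (𝓡 n) x x) = sphereFDeriv Y x (frame x i) := by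
  rw [partialDeriv_eq x i (by rwa [inChart_coe_center]), inChart_coe_center]
  rfl

theorem metricForm_coe (x : USphere n) :
    metricForm (fun y : USphere n => (y : Space n)) x = 1 := by
  ext i j
  simp only [metricForm, Matrix.of_apply, Matrix.one_apply]
  exact orthonormal_iff_ite.1 (orthonormal_frame x) i j

/-- Carries the immersion and normality conditions, stated on tangent spaces, over to
`sphereFDeriv`. -/
theorem mvfderiv_eq {Y : USphere n → Space n} (hY : ContMDiff (𝓡 n) 𝓘(ℝ, Space n) ∞ Y)
    (x : USphere n) (v : TangentSpace (𝓡 n) x) :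
    mvfderiv (𝓡 n) Y x v =
      sphereFDeriv Y x (mvfderiv (𝓡 n) ((↑) : USphere n → Space n) x v) := by
  have h : Y = (Y ∘ radialProj) ∘ ((↑) : USphere n → Space n) := by
    funext y; simp [radialProj_coe]
  have hd : DifferentiableAt ℝ (Y ∘ radialProj) (x : Space n) :=
    (contDiffAt_comp_radialProj hY (coe_ne_zero x)).differentiableAt (by simp)
  have := mfderiv_comp x hd.mdifferentiableAt
    ((contMDiff_coe 1).mdifferentiableAt (x := x) (by simp))
  rw [← h, mfderiv_eq_fderiv] at this
  exact congrArg (fun f => f v) this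

theorem exists_mvfderiv_coe_eq (x : USphere n) {y : Space n} (hy : ⟪(x : Space n), y⟫ = 0) :
    ∃ v : TangentSpace (𝓡 n) x, mvfderiv (𝓡 n) ((↑) : USphere n → Space n) x v = y := by
  have := Fact.mk (finrank_space n)
  have h := range_mvfderiv_subtypeVal (E := Space n) (n := n) x
  have hy' : y ∈ (ℝ ∙ (x : Space n))ᗮ := (Submodule.mem_orthogonal_singleton_iff_inner_right).2 hy
  rw [← h] at hy'
  exact hy'

end Differential

/-! ### Area density, normals and supporting hyperplanes -/

section Hypersurface

variable {Y : USphere n → Space n} {ν : USphere n → USphere n}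

theorem IsSmoothEmbedding.differentiableAt (h : IsSmoothEmbedding Y) {y : Space n} (hy : y ≠ 0) :
    DifferentiableAt ℝ (Y ∘ radialProj) y :=
  (contDiffAt_comp_radialProj h.smooth hy).differentiableAt (by simp)

theorem IsSmoothEmbedding.sphereFDeriv_self (h : IsSmoothEmbedding Y) (x : USphere n) :
    sphereFDeriv Y x (x : Space n) = 0 :=
  GaussFlow.sphereFDeriv_self (h.differentiableAt (coe_ne_zero x))

theorem IsSmoothEmbedding.eq_zero_of_sphereFDeriv_eq_zero (h : IsSmoothEmbedding Y) (x : USphere n)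
    {y : Space n} (hy : ⟪(x : Space n), y⟫ = 0) (hL : sphereFDeriv Y x y = 0) : y = 0 := by
  obtain ⟨v, rfl⟩ := exists_mvfderiv_coe_eq x hy
  rw [← mvfderiv_eq h.smooth] at hL
  have : v = 0 := h.immersion x (hL.trans (map_zero _).symm)
  rw [this, map_zero]

theorem IsOutwardNormal.inner_sphereFDeriv (h : IsOutwardNormal Y ν) (hY : IsSmoothEmbedding Y)
    (x : USphere n) (y : Space n) : ⟪sphereFDeriv Y x y, (ν x : Space n)⟫ = 0 := by
  have h0 : ⟪(x : Space n), y - ⟪(x : Space n), y⟫ • (x : Space n)⟫ = 0 := by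
    rw [inner_sub_right, inner_smul_right, inner_coe_self, mul_one, sub_self]
  obtain ⟨v, hv⟩ := exists_mvfderiv_coe_eq x h0
  have := h.normal x v
  rwa [mvfderiv_eq hY.smooth, hv, map_sub, map_smul, hY.sphereFDeriv_self, smul_zero,
    sub_zero] at this

theorem metricForm_eq (h : IsSmoothEmbedding Y) (x : USphere n) :
    metricForm Y x =
      Matrix.of fun i j => ⟪sphereFDeriv Y x (frame x i), sphereFDeriv Y x (frame x j)⟫ := by
  ext i j
  simp only [metricForm, Matrix.of_apply]
  rw [partialDeriv_center x i (h.differentiableAt (coe_ne_zero x)),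
    partialDeriv_center x j (h.differentiableAt (coe_ne_zero x))]

/-- The determinant of the differential of `Y`, completed by `x ↦ ν x` in the normal direction. -/
noncomputable def normalDet (Y : USphere n → Space n) (ν : USphere n → USphere n)
    (x : USphere n) : ℝ :=
  (augment (sphereFDeriv Y x) (ν x : Space n) (x : Space n)).det

theorem det_metricForm (h : IsSmoothEmbedding Y) (hν : IsOutwardNormal Y ν) (x : USphere n) :
    (metricForm Y x).det = normalDet Y ν x ^ 2 := by
  rw [metricForm_eq h, sq, normalDet, det_augment_mul_det_augment (finrank_space n) (norm_coe x)
    (norm_coe (ν x)) (h.sphereFDeriv_self x) (h.sphereFDeriv_self x) (hν.inner_sphereFDeriv h x)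
    (hν.inner_sphereFDeriv h x) (orthonormal_frame x) (inner_frame x)]

theorem areaDensity_eq (h : IsSmoothEmbedding Y) (hν : IsOutwardNormal Y ν) (x : USphere n) :
    areaDensity Y x = |normalDet Y ν x| := by
  rw [areaDensity, metricForm_coe, det_metricForm h hν, Real.sqrt_sq_eq_abs]
  simp

theorem normalDet_ne_zero (h : IsSmoothEmbedding Y) (hν : IsOutwardNormal Y ν) (x : USphere n) :
    normalDet Y ν x ≠ 0 := by
  intro h0
  obtain ⟨y, hy, hy0⟩ := Submodule.exists_mem_ne_zero_of_ne_bot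
    (LinearMap.bot_lt_ker_of_det_eq_zero h0).ne'
  have hy' : sphereFDeriv Y x y + ⟪(x : Space n), y⟫ • (ν x : Space n) = 0 := hy
  have hxy : ⟪(x : Space n), y⟫ = 0 := by
    have := congrArg (fun u => ⟪u, (ν x : Space n)⟫) hy'
    rwa [inner_add_left, inner_smul_left, hν.inner_sphereFDeriv h, inner_coe_self, zero_add,
      mul_one, inner_zero_left] at this
  rw [hxy, zero_smul, add_zero] at hy'
  exact hy0 (h.eq_zero_of_sphereFDeriv_eq_zero x hxy hy')

/-- A vector that is orthogonal to the tangent space is a multiple of the normal. -/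
theorem eq_smul_normal (h : IsSmoothEmbedding Y) (hν : IsOutwardNormal Y ν) (x : USphere n)
    {w : Space n} (hw : ∀ y, ⟪sphereFDeriv Y x y, w⟫ = 0) :
    w = ⟪w, (ν x : Space n)⟫ • (ν x : Space n) := by
  have hsurj : Function.Surjective
      (augment (sphereFDeriv Y x) (ν x : Space n) (x : Space n) : Space n →ₗ[ℝ] Space n) := by
    rw [← LinearMap.injective_iff_surjective, ← LinearMap.ker_eq_bot]
    by_contra hk
    exact normalDet_ne_zero h hν x (LinearMap.det_eq_zero_iff_ker_ne_bot.2 hk)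
  -- The residual of `w` is orthogonal to the tangent range and to `ν x`, hence to everything in the
  -- range of this surjective map, itself included.
  obtain ⟨y, hy⟩ := hsurj (w - ⟪w, (ν x : Space n)⟫ • (ν x : Space n))
  have hy' : sphereFDeriv Y x y + ⟪(x : Space n), y⟫ • (ν x : Space n)
      = w - ⟪w, (ν x : Space n)⟫ • (ν x : Space n) := hy
  rw [← sub_eq_zero, ← inner_self_eq_zero (𝕜 := ℝ)]
  nth_rw 1 [← hy']
  simp only [inner_add_left, inner_sub_right, inner_smul_left, inner_smul_right, hw,
    hν.inner_sphereFDeriv h, inner_coe_self, real_inner_comm]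
  simp only [conj_trivial]
  ring

theorem differentiable_partialDeriv (h : IsSmoothEmbedding Y) (x : USphere n) (j : Fin n) :
    Differentiable ℝ (partialDeriv Y x j) := by
  have hc : ContDiff ℝ ∞ (inChart Y x) := by
    rw [inChart_eq, contDiff_iff_contDiffAt]
    intro u
    exact (contDiffAt_comp_radialProj h.smooth (inChart_coe_ne_zero x u)).comp u
      (contDiff_inChart_coe x).contDiffAt
  exact ((hc.fderiv_right (m := ∞) (by simp)).clm_apply contDiff_const).differentiable (by simp)

theorem inner_partialDeriv_normal (h : IsSmoothEmbedding Y) (hν : IsOutwardNormal Y ν)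
    (x : USphere n) (j : Fin n) (u : EuclideanSpace ℝ (Fin n)) :
    ⟪partialDeriv Y x j u, (ν ((extChartAt (𝓡 n) x).symm u) : Space n)⟫ = 0 := by
  rw [partialDeriv_eq x j (h.differentiableAt (inChart_coe_ne_zero x u))]
  exact hν.inner_sphereFDeriv h _ _

/-- The enclosed body does not lie in a tangent hyperplane. -/
theorem IsStrictlyConvex.exists_inner_lt (h : IsStrictlyConvex Y ν) (hn : 1 ≤ n) (x : USphere n) :
    ∃ y, ⟪Y y - Y x, (ν x : Space n)⟫ < 0 := by
  by_contra! hc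
  have h0 : ∀ y, ⟪Y y - Y x, (ν x : Space n)⟫ = 0 := fun y => le_antisymm
    (h.outwardNormal.outward x _ (subset_convexHull ℝ _ (mem_range_self y))) (hc y)
  -- In a hyperplane the second form would vanish; `1 ≤ n` supplies a diagonal entry to contradict
  -- positivity.
  let i : Fin n := ⟨0, hn⟩
  have hsm : Differentiable ℝ (inChart Y x) := fun u => by
    rw [inChart_eq]
    exact (h.embedding.differentiableAt (inChart_coe_ne_zero x u)).comp u
      ((contDiff_inChart_coe x).differentiable (by simp) u)
  have h1 : ∀ u, ⟪partialDeriv Y x i u, (ν x : Space n)⟫ = 0 := by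
    intro u
    have hd := (hsm u).hasFDerivAt.inner ℝ (hasFDerivAt_const (ν x : Space n) u)
    have hconst : (fun u => ⟪inChart Y x u, (ν x : Space n)⟫)
        = fun _ => ⟪Y x, (ν x : Space n)⟫ := by
      funext u
      have := h0 ((extChartAt (𝓡 n) x).symm u)
      rwa [inner_sub_left, sub_eq_zero] at this
    rw [hconst] at hd
    have := congrArg (fun f => f (EuclideanSpace.single i 1))
      (hd.unique (hasFDerivAt_const _ u))
    simpa [partialDeriv, real_inner_comm] using this
  have h2 : secondForm Y ν x i i = 0 := by
    have hd := (differentiable_partialDeriv h.embedding x i (extChartAt (𝓡 n) x x)).hasFDerivAt.inner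
      ℝ (hasFDerivAt_const (ν x : Space n) _)
    have hconst : (fun u => ⟪partialDeriv Y x i u, (ν x : Space n)⟫) = fun _ => 0 := funext h1
    rw [hconst] at hd
    have := congrArg (fun f => f (EuclideanSpace.single i 1))
      (hd.unique (hasFDerivAt_const _ _))
    simpa [secondForm, partialDeriv₂, real_inner_comm] using this
  exact ((h.posDef x).diag_pos (i := i)).ne' h2

/-- At a maximum of `⟪Y, z⟫` the first derivative vanishes, so `z = ±ν x`; a point of the
hypersurface strictly below the tangent plane fixes the sign. -/
theorem IsStrictlyConvex.normal_eq_of_support (h : IsStrictlyConvex Y ν) (hn : 1 ≤ n)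
    {x z : USphere n} (hz : ∀ y, ⟪Y y - Y x, (z : Space n)⟫ ≤ 0) : ν x = z := by
  have hperp : ∀ y, ⟪sphereFDeriv Y x y, (z : Space n)⟫ = 0 := by
    intro y
    have hd := (h.embedding.differentiableAt (coe_ne_zero x)).hasFDerivAt.inner ℝ
      (hasFDerivAt_const (z : Space n) (x : Space n))
    have hmax : IsLocalMax (fun y => ⟪(Y ∘ radialProj) y, (z : Space n)⟫) (x : Space n) := by
      refine Filter.Eventually.of_forall fun y => ?_
      have := hz (radialProj y)
      rw [inner_sub_left] at this
      simp only [Function.comp_apply, radialProj_coe]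
      linarith
    have := congrArg (fun f => f y) (hmax.hasFDerivAt_eq_zero hd)
    simpa [sphereFDeriv, real_inner_comm] using this
  have hc := eq_smul_normal h.embedding h.outwardNormal x hperp
  set c := ⟪(z : Space n), (ν x : Space n)⟫
  have habs : |c| = 1 := by
    have := congrArg norm hc
    rwa [norm_smul, norm_coe, norm_coe, mul_one, eq_comm] at this
  obtain ⟨y, hy⟩ := h.exists_inner_lt hn x
  have hzy := hz y
  rw [hc, inner_smul_right] at hzy
  have hc0 : 0 ≤ c := by nlinarith
  rw [abs_of_nonneg hc0] at habs
  rw [habs, one_smul] at hc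
  exact (Subtype.ext hc).symm

end Hypersurface

/-! ### Differentiability of the normal and the Weingarten equations -/

section GaussMap

variable {Y : USphere n → Space n} {ν : USphere n → USphere n}

theorem fderiv_comp_radialProj_eq (h : IsSmoothEmbedding Y) {y : Space n} (hy : y ≠ 0) :
    fderiv ℝ (Y ∘ radialProj) y = ‖y‖⁻¹ • sphereFDeriv Y (radialProj y) := by
  have := (hasFDerivAt_comp_radialProj (h.differentiableAt (coe_ne_zero (radialProj y)))
    (norm_pos_iff.2 hy)).fderiv
  rwa [norm_smul_radialProj] at this

/-- No regularity of `ν` is assumed, so it is recovered from the differential of `Y`: near `x` it is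
the normalisation of a differentiable field `N` normal to the hypersurface. -/
theorem IsStrictlyConvex.differentiableAt_normal (h : IsStrictlyConvex Y ν) (hn : 1 ≤ n)
    (x : USphere n) :
    DifferentiableAt ℝ ((fun x => (ν x : Space n)) ∘ radialProj) (x : Space n) := by
  set F : Space n → Space n := Y ∘ radialProj
  set w := (ν x : Space n)
  let M : Space n → Space n →L[ℝ] Space n := fun y => augment (fderiv ℝ F y) w y
  have hMd : DifferentiableAt ℝ M (x : Space n) := by
    have h1 : DifferentiableAt ℝ (fderiv ℝ F) (x : Space n) :=
      ((contDiffAt_comp_radialProj h.embedding.smooth (coe_ne_zero x)).fderiv_right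
        (m := ∞) (by simp)).differentiableAt (by simp)
    have h2 : DifferentiableAt ℝ (fun y : Space n => (innerSL ℝ y).smulRight w) (x : Space n) :=
      ((ContinuousLinearMap.smulRightL ℝ (Space n) (Space n)).flip w ∘L
        innerSL ℝ).differentiableAt
    exact h1.add h2
  have hdet : (M x).det ≠ 0 := normalDet_ne_zero h.embedding h.outwardNormal x
  have hinv : ∀ y, (M y).det ≠ 0 → ∀ v, (M y).inverse (M y v) = v := by
    intro y hy v
    have := ContinuousLinearMap.inverse_equiv ((M y).toContinuousLinearEquivOfDetNeZero hy)
    rw [ContinuousLinearMap.coe_toContinuousLinearEquivOfDetNeZero] at this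
    rw [this]
    exact ((M y).toContinuousLinearEquivOfDetNeZero hy).symm_apply_apply v
  have hId : DifferentiableAt ℝ (fun y => (M y).inverse) (x : Space n) := by
    have hx : DifferentiableAt ℝ ContinuousLinearMap.inverse (M x) := by
      have := contDiffAt_map_inverse (𝕜 := ℝ) (n := 1)
        ((M x).toContinuousLinearEquivOfDetNeZero hdet)
      rw [ContinuousLinearMap.coe_toContinuousLinearEquivOfDetNeZero] at this
      exact this.differentiableAt (by simp)
    exact hx.comp _ hMd
  let e := EuclideanSpace.basisFun (Fin (n + 1)) ℝ
  -- `N y` is the inverse transpose of `M y` applied to `y`. It pairs to zero with the tangent range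
  -- and to `1` with `w`.
  let N : Space n → Space n := fun y => ∑ i, ⟪y, (M y).inverse (e i)⟫ • e i
  have hN : ∀ y v, ⟪N y, v⟫ = ⟪y, (M y).inverse v⟫ := by
    intro y v
    conv_rhs => rw [← e.sum_repr' v]
    simp only [N, sum_inner, inner_smul_left, map_sum, map_smul, inner_sum, inner_smul_right]
    exact Finset.sum_congr rfl fun i _ => mul_comm _ _
  have hNd : DifferentiableAt ℝ N (x : Space n) := by
    refine DifferentiableAt.fun_sum fun i _ => ?_
    exact (differentiableAt_id.inner ℝ (hId.clm_apply (differentiableAt_const _))).smul_const _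
  obtain ⟨p, hp⟩ := h.exists_inner_lt hn x
  have hNν : ∀ y : Space n, y ≠ 0 → (M y).det ≠ 0 →
      N y = ⟪N y, (ν (radialProj y) : Space n)⟫ • (ν (radialProj y) : Space n) ∧
      ⟪N y, w⟫ = 1 := by
    intro y hy hy'
    have hself : fderiv ℝ F y y = 0 := by
      have h1 := h.embedding.sphereFDeriv_self (radialProj y)
      rw [coe_radialProj hy, map_smul] at h1
      rw [fderiv_comp_radialProj_eq h.embedding hy]
      simpa using h1
    have hw : ⟪N y, w⟫ = 1 := by
      have h1 : M y y = ⟪y, y⟫ • w := by simp [M, hself]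
      have h2 := hN y (M y y)
      rw [hinv y hy', h1, inner_smul_right] at h2
      have : ⟪y, y⟫ ≠ 0 := inner_self_ne_zero.2 hy
      field_simp at h2
      linarith
    refine ⟨eq_smul_normal h.embedding h.outwardNormal _ fun v => ?_, hw⟩
    have h2 := hN y (M y (‖y‖ • v))
    rw [hinv y hy'] at h2
    have h3 : M y (‖y‖ • v) = sphereFDeriv Y (radialProj y) v + ⟪y, ‖y‖ • v⟫ • w := by
      simp only [M, augment_apply, F]
      rw [fderiv_comp_radialProj_eq h.embedding hy, map_smul]
      simp [smul_smul, mul_inv_cancel₀ (norm_ne_zero_iff.2 hy)]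
    rw [h3, inner_add_right, inner_smul_right, hw, mul_one] at h2
    rw [real_inner_comm]
    linarith
  have hNx : N x = w := by
    obtain ⟨h1, h2⟩ := hNν x (coe_ne_zero x) hdet
    rw [radialProj_coe] at h1
    rw [h1]
    show ⟪N x, w⟫ • w = w
    rw [h2, one_smul]
  have hFc : ContinuousAt F (x : Space n) :=
    (h.embedding.differentiableAt (coe_ne_zero x)).continuousAt
  -- Selects the outward sign: `p` stays strictly on the negative side of `N y` for `y` near `x`.
  have hneg : ∀ᶠ y in nhds (x : Space n), ⟪Y p - F y, N y⟫ < 0 := by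
    have hc : ContinuousAt (fun y => ⟪Y p - F y, N y⟫) (x : Space n) :=
      (continuousAt_const.sub hFc).inner hNd.continuousAt
    refine hc.eventually_lt_const ?_
    show ⟪Y p - F x, N x⟫ < 0
    rw [hNx]
    simpa [F, radialProj_coe] using hp
  have hdetn : ∀ᶠ y in nhds (x : Space n), (M y).det ≠ 0 :=
    (ContinuousLinearMap.continuous_det.continuousAt.comp hMd.continuousAt).eventually_ne hdet
  have hNx0 : N x ≠ 0 := by rw [hNx]; exact coe_ne_zero _
  have hd : DifferentiableAt ℝ (fun y => ‖N y‖⁻¹ • N y) (x : Space n) :=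
    ((hNd.norm ℝ hNx0).inv (norm_ne_zero_iff.2 hNx0)).smul hNd
  refine hd.congr_of_eventuallyEq ?_
  filter_upwards [hneg, hdetn, isOpen_ne.mem_nhds (coe_ne_zero x)] with y hy1 hy2 hy3
  obtain ⟨h1, -⟩ := hNν y hy3 hy2
  set c := ⟪N y, (ν (radialProj y) : Space n)⟫
  have hout : ⟪Y p - F y, (ν (radialProj y) : Space n)⟫ ≤ 0 :=
    h.outwardNormal.outward _ _ (subset_convexHull ℝ _ (mem_range_self p))
  rw [h1, inner_smul_right] at hy1
  have hc : 0 < c := by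
    by_contra! hc
    nlinarith
  rw [h1, norm_smul, norm_coe, mul_one, Real.norm_of_nonneg hc.le, smul_smul,
    inv_mul_cancel₀ hc.ne', one_smul]
  rfl

theorem IsStrictlyConvex.sphereFDeriv_normal_self (h : IsStrictlyConvex Y ν) (hn : 1 ≤ n)
    (x : USphere n) : sphereFDeriv (fun x => (ν x : Space n)) x (x : Space n) = 0 :=
  sphereFDeriv_self (h.differentiableAt_normal hn x)

theorem IsStrictlyConvex.inner_sphereFDeriv_normal (h : IsStrictlyConvex Y ν) (hn : 1 ≤ n)
    (x : USphere n) (y : Space n) :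
    ⟪sphereFDeriv (fun x => (ν x : Space n)) x y, (ν x : Space n)⟫ = 0 := by
  have hd := (h.differentiableAt_normal hn x).hasFDerivAt
  have hd2 := hd.inner ℝ hd
  have hconst : (fun y => ⟪((fun x => (ν x : Space n)) ∘ radialProj) y,
      ((fun x => (ν x : Space n)) ∘ radialProj) y⟫) = fun _ => 1 :=
    funext fun y => inner_coe_self _
  rw [hconst] at hd2
  have := congrArg (fun f => f y) (hd2.unique (hasFDerivAt_const _ _))
  simp only [ContinuousLinearMap.comp_apply, ContinuousLinearMap.prod_apply,
    fderivInnerCLM_apply, Function.comp_apply, radialProj_coe, _root_.zero_apply]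
    at this
  rw [real_inner_comm (ν x : Space n)] at this
  simp only [sphereFDeriv]
  linarith [real_inner_comm ((ν x : Space n)) (fderiv ℝ ((fun x => (ν x : Space n)) ∘ radialProj) x y)]

/-- The Weingarten equations. -/
theorem IsStrictlyConvex.secondForm_eq (h : IsStrictlyConvex Y ν) (hn : 1 ≤ n) (x : USphere n) :
    secondForm Y ν x = Matrix.of fun i j =>
      ⟪sphereFDeriv Y x (frame x j), sphereFDeriv (fun x => (ν x : Space n)) x (frame x i)⟫ := by
  ext i j
  simp only [secondForm, Matrix.of_apply]
  set c := extChartAt (𝓡 n) x x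
  have hd1 := (differentiable_partialDeriv h.embedding x j c).hasFDerivAt
  have hν : HasFDerivAt ((fun x => (ν x : Space n)) ∘ radialProj)
      (sphereFDeriv (fun x => (ν x : Space n)) x) (inChart (↑) x c) := by
    rw [inChart_coe_center]
    exact (h.differentiableAt_normal hn x).hasFDerivAt
  have hd2 := hν.comp c ((contDiff_inChart_coe x).differentiable (by simp) c).hasFDerivAt
  have hd := hd1.inner ℝ hd2
  have hconst : (fun u => ⟪partialDeriv Y x j u,
      (((fun x => (ν x : Space n)) ∘ radialProj) ∘ inChart (↑) x) u⟫) = fun _ => 0 := by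
    funext u
    have := inner_partialDeriv_normal h.embedding h.outwardNormal x j u
    simpa [inChart, radialProj_coe] using this
  rw [hconst] at hd
  have := congrArg (fun f => f (EuclideanSpace.single i 1)) (hd.unique (hasFDerivAt_const _ _))
  simp only [ContinuousLinearMap.comp_apply, ContinuousLinearMap.prod_apply,
    fderivInnerCLM_apply, Function.comp_apply, _root_.zero_apply]
    at this
  rw [partialDeriv_center x j (h.embedding.differentiableAt (coe_ne_zero x))] at this
  have hx : radialProj (inChart (↑) x c) = x := by rw [inChart_coe_center, radialProj_coe]
  rw [hx] at this
  have h2 : fderiv ℝ (inChart (↑) x) c (EuclideanSpace.single i 1) = frame x i := rfl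
  rw [h2] at this
  simp only [partialDeriv₂]
  linarith

/-- The mixed Gram matrix of `dY` and `dν` is the transposed second form. -/
theorem IsStrictlyConvex.normalDet_mul_normalDet (h : IsStrictlyConvex Y ν) (hn : 1 ≤ n)
    (x : USphere n) :
    normalDet Y ν x * normalDet (fun x => (ν x : Space n)) ν x = (secondForm Y ν x).det := by
  rw [h.secondForm_eq hn, ← Matrix.det_transpose, normalDet, normalDet,
    det_augment_mul_det_augment (finrank_space n) (norm_coe x)
    (norm_coe (ν x)) (h.embedding.sphereFDeriv_self x) (h.sphereFDeriv_normal_self hn x)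
    (h.outwardNormal.inner_sphereFDeriv h.embedding x)
    (h.inner_sphereFDeriv_normal hn x) (orthonormal_frame x) (inner_frame x)]
  rfl

theorem IsStrictlyConvex.gaussCurvature_eq (h : IsStrictlyConvex Y ν) (x : USphere n) :
    gaussCurvature Y ν x = (secondForm Y ν x).det / normalDet Y ν x ^ 2 := by
  rw [gaussCurvature, Matrix.det_mul, Matrix.det_nonsing_inv,
    det_metricForm h.embedding h.outwardNormal, Ring.inverse_eq_inv']
  field_simp

theorem IsStrictlyConvex.gaussCurvature_pos (h : IsStrictlyConvex Y ν) (x : USphere n) :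
    0 < gaussCurvature Y ν x := by
  rw [h.gaussCurvature_eq]
  exact div_pos (h.posDef x).det_pos
    (by have := normalDet_ne_zero h.embedding h.outwardNormal x; positivity)

/-- The Jacobian of the Gauss map with respect to the surface measure is the Gauss curvature. -/
theorem IsStrictlyConvex.abs_normalDet_normal (h : IsStrictlyConvex Y ν) (hn : 1 ≤ n)
    (x : USphere n) :
    |normalDet (fun x => (ν x : Space n)) ν x| = gaussCurvature Y ν x * areaDensity Y x := by
  have h1 := h.normalDet_mul_normalDet hn x
  have h0 := normalDet_ne_zero h.embedding h.outwardNormal x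
  rw [h.gaussCurvature_eq, areaDensity_eq h.embedding h.outwardNormal, ← sq_abs,
    ← abs_of_pos (h.posDef x).det_pos, ← h1, abs_mul]
  have : |normalDet Y ν x| ≠ 0 := abs_ne_zero.2 h0
  field_simp

end GaussMap

/-! ### The cone map and its derivative -/

section Cone

theorem hasFDerivAt_norm_smul_coe (x : USphere n) {r : ℝ} (hr : 0 < r) :
    HasFDerivAt (fun y : Space n => ‖y‖) (innerSL ℝ (x : Space n)) (r • (x : Space n)) := by
  have hnorm : ‖r • (x : Space n)‖ = r := by
    rw [norm_smul, norm_coe, mul_one, Real.norm_of_nonneg hr.le]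
  have h := (hasStrictFDerivAt_norm_sq (r • (x : Space n))).hasFDerivAt.sqrt
    (by rw [hnorm]; positivity)
  simp only [Real.sqrt_sq (norm_nonneg _)] at h
  rw [hnorm] at h
  refine h.congr_fderiv ?_
  ext1 y
  simp only [smul_apply, innerSL_apply_apply, inner_smul_left, smul_eq_mul, nsmul_eq_mul,
    conj_trivial]
  push_cast
  field_simp

/-- The cone map `y ↦ ‖y‖ Z(y / ‖y‖)`. -/
noncomputable def coneMap (Z : USphere n → Space n) (y : Space n) : Space n :=
  ‖y‖ • Z (radialProj y)

theorem coneMap_smul (Z : USphere n → Space n) (x : USphere n) {r : ℝ} (hr : 0 < r) :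
    coneMap Z (r • (x : Space n)) = r • Z x := by
  rw [coneMap, radialProj_smul x hr, norm_smul, norm_coe, mul_one, Real.norm_of_nonneg hr.le]

/-- Homogeneity of degree one makes the derivative independent of `r`. -/
theorem hasFDerivAt_coneMap {Z : USphere n → Space n} {x : USphere n}
    (hZ : DifferentiableAt ℝ (Z ∘ radialProj) (x : Space n)) {r : ℝ} (hr : 0 < r) :
    HasFDerivAt (coneMap Z) (augment (sphereFDeriv Z x) (Z x) (x : Space n))
      (r • (x : Space n)) := by
  have h := (hasFDerivAt_norm_smul_coe x hr).smul (hasFDerivAt_comp_radialProj hZ hr)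
  refine h.congr_fderiv ?_
  ext1 y
  rw [norm_smul, norm_coe, mul_one, Real.norm_of_nonneg hr.le, smul_smul, mul_inv_cancel₀ hr.ne',
    one_smul, Function.comp_apply, radialProj_smul x hr]
  rfl

end Cone

/-! ### Bijectivity of the Gauss map -/

section GaussMap

variable {Y : USphere n → Space n} {ν : USphere n → USphere n}

theorem IsStrictlyConvex.continuous_normal (h : IsStrictlyConvex Y ν) (hn : 1 ≤ n) :
    Continuous ν := by
  rw [Topology.IsInducing.subtypeVal.continuous_iff, continuous_iff_continuousAt]
  intro x
  have h1 := (h.differentiableAt_normal hn x).continuousAt.comp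
    (continuous_subtype_val (p := fun y => y ∈ Metric.sphere (0 : Space n) 1)).continuousAt
  simpa [Function.comp_def, radialProj_coe] using h1

theorem IsStrictlyConvex.isClosed_enclosedBody (h : IsStrictlyConvex Y ν) :
    IsClosed (enclosedBody Y) := by
  rw [← frontier_subset_iff_isClosed, h.boundary]
  exact subset_convexHull ℝ _

theorem convex_enclosedBody (Y : USphere n → Space n) : Convex ℝ (enclosedBody Y) :=
  convex_convexHull ℝ _

theorem mem_enclosedBody (Y : USphere n → Space n) (x : USphere n) : Y x ∈ enclosedBody Y :=
  subset_convexHull ℝ _ (mem_range_self x)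

theorem IsStrictlyConvex.continuous (h : IsStrictlyConvex Y ν) : Continuous Y :=
  h.embedding.smooth.continuous

theorem IsStrictlyConvex.surjective_normal (h : IsStrictlyConvex Y ν) (hn : 1 ≤ n) :
    Function.Surjective ν := by
  intro z
  have : Nonempty (USphere n) := ⟨z⟩
  obtain ⟨x, -, hx⟩ := isCompact_univ.exists_isMaxOn univ_nonempty
    (f := fun y => ⟪Y y, (z : Space n)⟫) (h.continuous.inner continuous_const).continuousOn
  refine ⟨x, h.normal_eq_of_support hn fun y => ?_⟩
  have := hx (mem_univ y)
  simp only [mem_ofPred_eq] at this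
  rw [inner_sub_left]
  linarith

/-- The cone map of `ν` has an invertible derivative at `x`, because `det h` is positive, so it does
not take its value at `x` again nearby. -/
theorem IsStrictlyConvex.eventually_normal_ne (h : IsStrictlyConvex Y ν) (hn : 1 ≤ n)
    (x : USphere n) : ∀ᶠ y in nhds x, ν y = ν x → y = x := by
  have hd := hasFDerivAt_coneMap (h.differentiableAt_normal hn x) one_pos
  rw [one_smul] at hd
  have hdet : normalDet (fun x => (ν x : Space n)) ν x ≠ 0 := fun h0 =>
    (h.posDef x).det_pos.ne' (by rw [← h.normalDet_mul_normalDet hn, h0, mul_zero])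
  set A := (augment (sphereFDeriv (fun x => (ν x : Space n)) x) (ν x : Space n)
    (x : Space n)).toContinuousLinearEquivOfDetNeZero hdet
  have hne := hd.eventually_ne (c := (ν x : Space n)) ⟨_, A.antilipschitz⟩
  rw [eventually_nhdsWithin_iff] at hne
  have hc := (continuous_subtype_val (p := fun y =>
    y ∈ Metric.sphere (0 : Space n) 1)).continuousAt (x := x)
  filter_upwards [hc.eventually hne] with y hy hν
  by_contra hyx
  refine hy (fun h => hyx (Subtype.ext h)) ?_
  have := coneMap_smul (fun x => (ν x : Space n)) y one_pos
  rw [one_smul, one_smul] at this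
  rw [this, hν]

theorem IsStrictlyConvex.injective_normal (h : IsStrictlyConvex Y ν) (hn : 1 ≤ n) :
    Function.Injective ν := by
  intro x y hxy
  by_contra hne
  have hY : Y x ≠ Y y := fun h' => hne (h.embedding.injective h')
  obtain ⟨U, hU, hUo, hxU⟩ := eventually_nhds_iff.1 (h.eventually_normal_ne hn x)
  have hK : IsClosed (Y '' Uᶜ) := (hUo.isClosed_compl.isCompact.image h.continuous).isClosed
  have hxK : Y x ∉ Y '' Uᶜ := by
    rintro ⟨x', hx', he⟩
    exact hx' (h.embedding.injective he ▸ hxU)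
  have hout : ∀ w, ∀ p ∈ enclosedBody Y, ⟪p - Y w, (ν w : Space n)⟫ ≤ 0 := h.outwardNormal.outward
  -- With a common normal each point supports the body at the other, so the segment lies in one
  -- supporting hyperplane.
  have hlevel : ⟪Y y - Y x, (ν x : Space n)⟫ = 0 := by
    refine le_antisymm (hout x _ (mem_enclosedBody Y y)) ?_
    have := hout y _ (mem_enclosedBody Y x)
    rw [← hxy, ← neg_sub, inner_neg_left] at this
    linarith
  let p : ℝ → Space n := fun s => Y x + s • (Y y - Y x)
  have hpc : Continuous p := by fun_prop
  have hev : ∀ᶠ s in nhdsWithin (0 : ℝ) (Ioi 0), p s ∉ Y '' Uᶜ := by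
    have : p 0 ∉ Y '' Uᶜ := by simpa [p] using hxK
    exact (hpc.continuousAt.eventually (hK.isOpen_compl.mem_nhds this)).filter_mono
      nhdsWithin_le_nhds
  obtain ⟨s, hs, hs0, hs1⟩ := (hev.and (Ioo_mem_nhdsGT (zero_lt_one' ℝ))).exists
  have hpb : p s ∈ enclosedBody Y :=
    (convex_enclosedBody Y).add_smul_sub_mem (mem_enclosedBody Y x) (mem_enclosedBody Y y)
      ⟨hs0.le, hs1.le⟩
  have hplevel : ⟪p s - Y x, (ν x : Space n)⟫ = 0 := by
    simp [p, inner_smul_left, hlevel]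
  -- An interior point could be pushed a little along `ν x`, beyond the supporting hyperplane.
  have hpf : p s ∈ frontier (enclosedBody Y) := by
    refine ⟨subset_closure hpb, fun hint => ?_⟩
    have hcont : Continuous fun ε : ℝ => p s + ε • (ν x : Space n) := by fun_prop
    have h0 : (fun ε : ℝ => p s + ε • (ν x : Space n)) 0 ∈ interior (enclosedBody Y) := by
      simpa using hint
    have hev := (hcont.continuousAt.eventually (isOpen_interior.mem_nhds h0)).filter_mono
      (nhdsWithin_le_nhds (s := Ioi 0))
    obtain ⟨ε, hε, hε0⟩ := (hev.and self_mem_nhdsWithin).exists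
    have := hout x _ (interior_subset hε)
    rw [add_sub_right_comm, inner_add_left, hplevel, inner_smul_left, inner_coe_self] at this
    simp only [conj_trivial] at this
    have hε0 : 0 < ε := hε0
    linarith
  rw [h.boundary] at hpf
  obtain ⟨x', hx'⟩ := hpf
  -- The segment point `Y x'` lies on the same supporting hyperplane, so it has the same normal; as
  -- `x'` is in `U`, this forces `x' = x`.
  have hνx' : ν x' = ν x := by
    refine h.normal_eq_of_support hn fun w => ?_
    have := hout x _ (mem_enclosedBody Y w)
    rw [hx', ← sub_add_sub_cancel' (Y x), inner_add_left]
    rw [← neg_sub, inner_neg_left, hplevel]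
    linarith
  have hx'U : x' ∈ U := by
    by_contra hc
    exact hs ⟨x', hc, hx'⟩
  have := hU x' hx'U hνx'
  rw [this] at hx'
  have h0 : s • (Y y - Y x) = 0 := by
    have : Y x = Y x + s • (Y y - Y x) := hx'
    simpa using this
  rcases smul_eq_zero.1 h0 with h0 | h0
  · exact hs0.ne' h0
  · exact hY (sub_eq_zero.1 h0).symm

theorem IsStrictlyConvex.bijective_normal (h : IsStrictlyConvex Y ν) (hn : 1 ≤ n) :
    Function.Bijective ν :=
  ⟨h.injective_normal hn, h.surjective_normal hn⟩

/-- A body inside a hyperplane would be supported at `Y x` by both unit normals of the hyperplane,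
and both would equal `ν x`. -/
theorem IsStrictlyConvex.interior_nonempty (h : IsStrictlyConvex Y ν) (hn : 1 ≤ n)
    (x : USphere n) : (interior (enclosedBody Y)).Nonempty := by
  rw [(convex_enclosedBody Y).interior_nonempty_iff_affineSpan_eq_top]
  by_contra hspan
  set S := affineSpan ℝ (enclosedBody Y)
  have hmem : ∀ y, Y y ∈ S := fun y => subset_affineSpan ℝ _ (mem_enclosedBody Y y)
  have hdir : S.direction ≠ ⊤ := fun hd =>
    hspan ((AffineSubspace.direction_eq_top_iff_of_nonempty ⟨_, hmem x⟩).1 hd)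
  have hperp : S.directionᗮ ≠ ⊥ := fun hb => hdir (Submodule.orthogonal_eq_bot_iff.1 hb)
  obtain ⟨w, hw, hw0⟩ := Submodule.exists_mem_ne_zero_of_ne_bot hperp
  have hwz : ∀ y, ⟪Y y - Y x, w⟫ = 0 := fun y =>
    (Submodule.mem_orthogonal _ _).1 hw _ (AffineSubspace.vsub_mem_direction (hmem y) (hmem x))
  have hz := coe_radialProj hw0
  have h1 : ν x = radialProj w := h.normal_eq_of_support hn fun y => by
    rw [hz, inner_smul_right, hwz, mul_zero]
  have h2 : ν x = -radialProj w := h.normal_eq_of_support hn fun y => by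
    rw [coe_neg_sphere, inner_neg_right, hz, inner_smul_right, hwz, mul_zero, neg_zero]
  exact ne_neg_of_mem_unit_sphere ℝ (radialProj w) (h1.symm.trans h2)

end GaussMap

/-! ### Volume of a cone over a spherical set -/

section ConeVolume

open scoped ENNReal Pointwise

theorem measurable_det_fderiv (F : Space n → Space n) :
    Measurable fun y => ENNReal.ofReal |(fderiv ℝ F y).det| :=
  (ContinuousLinearMap.continuous_det.measurable.comp (measurable_fderiv ℝ F)).abs.ennreal_ofReal

theorem setLIntegral_ofReal_pow (n : ℕ) :
    ∫⁻ r in Ioo (0 : ℝ) 1, ENNReal.ofReal (r ^ n) = ENNReal.ofReal (1 / ((n : ℝ) + 1)) := by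
  rw [Measure.restrict_congr_set Ioo_ae_eq_Ioc, ← ofReal_integral_eq_lintegral_ofReal
    (intervalIntegral.intervalIntegrable_pow n).1, ← intervalIntegral.integral_of_le zero_le_one]
  · simp
  · filter_upwards [ae_restrict_mem measurableSet_Ioc] with y hy
    exact pow_nonneg hy.1.le _

/-- The Jacobian is constant along rays, so the radial integral separates and leaves `∫₀¹ r ^ n = 1
/ (n + 1)`. -/
theorem volume_image_coneMap {Z : USphere n → Space n}
    (hZ : ∀ x : USphere n, DifferentiableAt ℝ (Z ∘ radialProj) (x : Space n))
    (hinj : InjOn (coneMap Z) {0}ᶜ) {A : Set (USphere n)} (hA : MeasurableSet A) :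
    volume (coneMap Z '' {y | ‖y‖ ∈ Ioo (0 : ℝ) 1 ∧ radialProj y ∈ A}) =
      (∫⁻ x in A, ENNReal.ofReal |(augment (sphereFDeriv Z x) (Z x) (x : Space n)).det|
        ∂(sphereMeasure n)) * ENNReal.ofReal (1 / ((n : ℝ) + 1)) := by
  have hmA : MeasurableSet {y : Space n | radialProj y ∈ A} := measurable_radialProj hA
  have hmI : MeasurableSet {y : Space n | ‖y‖ ∈ Ioo (0 : ℝ) 1} := measurable_norm measurableSet_Ioo
  have hset : {y : Space n | ‖y‖ ∈ Ioo (0 : ℝ) 1 ∧ radialProj y ∈ A}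
    = {y | radialProj y ∈ A} ∩ {y | ‖y‖ ∈ Ioo (0 : ℝ) 1} := by
    ext y; exact and_comm
  have hd : ∀ x : USphere n, ∀ r : ℝ, 0 < r → HasFDerivAt (coneMap Z)
      (augment (sphereFDeriv Z x) (Z x) (x : Space n)) (r • (x : Space n)) :=
    fun x r hr => hasFDerivAt_coneMap (hZ x) hr
  have hne : ∀ y : Space n, ‖y‖ ∈ Ioo (0 : ℝ) 1 → y ≠ 0 := fun y hy => norm_pos_iff.1 hy.1
  have hderiv : ∀ y ∈ {y : Space n | radialProj y ∈ A} ∩ {y | ‖y‖ ∈ Ioo (0 : ℝ) 1},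
      HasFDerivWithinAt (coneMap Z) (fderiv ℝ (coneMap Z) y)
        ({y | radialProj y ∈ A} ∩ {y | ‖y‖ ∈ Ioo (0 : ℝ) 1}) y := by
    intro y hy
    have := hd (radialProj y) ‖y‖ hy.2.1
    rw [norm_smul_radialProj] at this
    exact this.differentiableAt.hasFDerivAt.hasFDerivWithinAt
  rw [hset, ← lintegral_abs_det_fderiv_eq_addHaar_image volume (hmA.inter hmI) hderiv
    (hinj.mono fun y hy => hne y hy.2), ← Measure.restrict_restrict hmA, ← lintegral_indicator hmA,
    setLIntegral_eq_lintegral_polar ((measurable_det_fderiv _).indicator hmA) measurableSet_Ioo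
      Ioo_subset_Ioi_self, ← setLIntegral_ofReal_pow n,
    ← lintegral_const_mul _ (by fun_prop)]
  refine setLIntegral_congr_fun measurableSet_Ioo fun r hr => ?_
  congr 1
  rw [← lintegral_indicator hA]
  refine lintegral_congr fun x => ?_
  have hmem : r • (x : Space n) ∈ {y : Space n | radialProj y ∈ A} ↔ x ∈ A := by
    rw [mem_ofPred_eq, radialProj_smul x hr.1]
  by_cases hx : x ∈ A
  · rw [indicator_of_mem (hmem.2 hx), indicator_of_mem hx, (hd x r hr.1).fderiv]
  · rw [indicator_of_notMem (fun h => hx (hmem.1 h)), indicator_of_notMem hx]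

end ConeVolume

/-! ### Change of variables by the Gauss map -/

section GaussMap

open scoped ENNReal Pointwise

variable {Y : USphere n → Space n} {ν : USphere n → USphere n}

theorem injOn_coneMap_normal (hν : Function.Injective ν) :
    InjOn (coneMap fun x => (ν x : Space n)) {0}ᶜ := by
  intro y hy y' hy' he
  have hn := congrArg norm he
  simp only [coneMap, norm_smul, norm_coe, mul_one, norm_norm] at hn
  simp only [coneMap] at he
  rw [hn] at he
  have h1 := hν (Subtype.ext (smul_right_injective _ (norm_ne_zero_iff.2 hy') he))
  rw [← norm_smul_radialProj y, ← norm_smul_radialProj y', hn, h1]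

theorem IsStrictlyConvex.measurable_jacobian (h : IsStrictlyConvex Y ν) (hn : 1 ≤ n) :
    Measurable fun x => ENNReal.ofReal (gaussCurvature Y ν x * areaDensity Y x) := by
  have := (measurable_det_fderiv (coneMap fun x => (ν x : Space n))).comp
    (measurable_subtype_coe (p := fun y => y ∈ Metric.sphere (0 : Space n) 1))
  convert this using 2 with x
  have hd := hasFDerivAt_coneMap (h.differentiableAt_normal hn x) one_pos
  rw [one_smul] at hd
  rw [Function.comp_apply, hd.fderiv, ← h.abs_normalDet_normal hn]
  rfl

/-- The Gauss map pushes the surface measure weighted with the Gauss curvature forward to the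
standard measure of the sphere. -/
theorem IsStrictlyConvex.map_normal (h : IsStrictlyConvex Y ν) (hn : 1 ≤ n) :
    ((sphereMeasure n).withDensity fun x =>
      ENNReal.ofReal (gaussCurvature Y ν x * areaDensity Y x)).map ν = sphereMeasure n := by
  ext s hs
  have hm := (h.continuous_normal hn).measurable hs
  rw [Measure.map_apply (h.continuous_normal hn).measurable hs, withDensity_apply _ hm]
  have hv := volume_image_coneMap (h.differentiableAt_normal hn)
    (injOn_coneMap_normal (h.injective_normal hn)) hm
  -- The image is the truncated cone over `s`, whose volume times `n + 1` is by definition the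
  -- `toSphere` measure of `s`.
  have himg : coneMap (fun x => (ν x : Space n)) '' {y | ‖y‖ ∈ Ioo (0 : ℝ) 1 ∧
      radialProj y ∈ ν ⁻¹' s} = Ioo (0 : ℝ) 1 • (((↑) : USphere n → Space n) '' s) := by
    ext p
    simp only [mem_image, mem_smul, mem_ofPred_eq, mem_preimage]
    constructor
    · rintro ⟨y, ⟨hy, hys⟩, rfl⟩
      exact ⟨‖y‖, hy, _, ⟨_, hys, rfl⟩, rfl⟩
    · rintro ⟨r, hr, _, ⟨z, hz, rfl⟩, rfl⟩
      obtain ⟨x, rfl⟩ := h.surjective_normal hn z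
      refine ⟨r • (x : Space n), ?_, coneMap_smul _ x hr.1⟩
      rw [radialProj_smul x hr.1, norm_smul, norm_coe, mul_one, Real.norm_of_nonneg hr.1.le]
      exact ⟨hr, hz⟩
  rw [himg] at hv
  rw [sphereMeasure, Measure.toSphere_apply' _ hs, finrank_space, hv, mul_comm, mul_assoc,
    ← ENNReal.ofReal_natCast, ← ENNReal.ofReal_mul (by positivity)]
  have : (1 / ((n : ℝ) + 1)) * ((n + 1 : ℕ) : ℝ) = 1 := by push_cast; field_simp
  rw [this, ENNReal.ofReal_one, mul_one]
  refine lintegral_congr fun x => ?_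
  rw [← h.abs_normalDet_normal hn]
  rfl

/-- `f` may be arbitrary because `ν`, a continuous injection of a compact space, is a measurable
embedding. -/
theorem IsStrictlyConvex.integral_normal (h : IsStrictlyConvex Y ν) (hn : 1 ≤ n)
    (f : USphere n → ℝ) :
    ∫ z, f z ∂(sphereMeasure n) =
      ∫ x, gaussCurvature Y ν x * areaDensity Y x * f (ν x) ∂(sphereMeasure n) := by
  have hemb : MeasurableEmbedding ν :=
    ((h.continuous_normal hn).isClosedEmbedding (h.injective_normal hn)).measurableEmbedding
  conv_lhs => rw [← h.map_normal hn]
  rw [hemb.integral_map, integral_withDensity_eq_integral_toReal_smul (h.measurable_jacobian hn)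
    (Filter.Eventually.of_forall fun _ => ENNReal.ofReal_lt_top)]
  refine integral_congr_ae (Filter.Eventually.of_forall fun x => ?_)
  simp only [smul_eq_mul]
  rw [ENNReal.toReal_ofReal (by rw [← h.abs_normalDet_normal hn]; exact abs_nonneg _)]

end GaussMap

/-! ### The two volume formulas -/

section Volume

variable {Y : USphere n → Space n} {ν : USphere n → USphere n}

theorem continuous_sphereFDeriv (h : IsSmoothEmbedding Y) : Continuous (sphereFDeriv Y) := by
  have h1 : ContinuousOn (fderiv ℝ (Y ∘ radialProj)) {0}ᶜ :=
    (contDiffOn_comp_radialProj h.smooth).continuousOn_fderiv_of_isOpen isOpen_compl_singleton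
      (by simp)
  exact h1.comp_continuous continuous_subtype_val coe_ne_zero

theorem IsStrictlyConvex.continuous_areaDensity (h : IsStrictlyConvex Y ν) (hn : 1 ≤ n) :
    Continuous (areaDensity Y) := by
  have : areaDensity Y = fun x => |normalDet Y ν x| :=
    funext (areaDensity_eq h.embedding h.outwardNormal)
  rw [this]
  refine (ContinuousLinearMap.continuous_det.comp (continuous_augment.comp
    ((continuous_sphereFDeriv h.embedding).prodMk
      ((continuous_subtype_val.comp (h.continuous_normal hn)).prodMk continuous_subtype_val)))).abs

theorem isBounded_enclosedBody (h : Continuous Y) : Bornology.IsBounded (enclosedBody Y) :=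
  isBounded_convexHull.2 (isCompact_range h).isBounded

theorem areaDensity_nonneg (x : USphere n) : 0 ≤ areaDensity Y x := by
  unfold areaDensity; positivity

/-- The gauge of the body translated by `-c` equals `1` on its boundary, so it reads off the radius
in the cone over `Y - c`. The cone map is therefore injective and fills the interior minus the apex;
the boundary of a convex set is null. -/
theorem IsStrictlyConvex.enclosedVolume_eq_of_mem_interior (h : IsStrictlyConvex Y ν) (hn : 1 ≤ n)
    {c : Space n} (hc : c ∈ interior (enclosedBody Y)) :
    enclosedVolume Y = 1 / ((n : ℝ) + 1) *
      ∫ x, ⟪Y x - c, (ν x : Space n)⟫ * areaDensity Y x ∂(sphereMeasure n) := by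
  let Z : USphere n → Space n := fun x => Y x - c
  let τ : Space n ≃ₜ Space n := Homeomorph.addRight c
  let C : Set (Space n) := τ ⁻¹' enclosedBody Y
  have hCconv : Convex ℝ C := (convex_enclosedBody Y).translate_preimage_left c
  have hCint : interior C = τ ⁻¹' interior (enclosedBody Y) := (τ.preimage_interior _).symm
  have hC0 : C ∈ nhds (0 : Space n) := by
    rw [mem_interior_iff_mem_nhds.symm, hCint]
    simpa [τ] using hc
  have hCf : frontier C = range Z := by
    rw [← τ.preimage_frontier, h.boundary]
    ext q
    simp only [mem_preimage, mem_range, τ, Z, Homeomorph.coe_addRight, sub_eq_iff_eq_add]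
  have hCb : Bornology.IsVonNBounded ℝ C := by
    rw [NormedSpace.isVonNBounded_iff]
    have : C = (fun p => p + -c) '' enclosedBody Y := by
      rw [image_add_right, neg_neg]; rfl
    rw [this]
    exact (isometry_add_right (-c)).lipschitz.isBounded_image (isBounded_enclosedBody h.continuous)
  have hgauge : ∀ x, gauge C (Z x) = 1 := fun x =>
    (gauge_eq_one_iff_mem_frontier hCconv hC0).2 (hCf ▸ mem_range_self x)
  have hZinj : Function.Injective Z := fun x y hxy =>
    h.embedding.injective (sub_left_injective hxy)
  have hgcone : ∀ y, gauge C (coneMap Z y) = ‖y‖ := fun y => by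
    rw [coneMap, gauge_smul_of_nonneg (norm_nonneg y), hgauge, smul_eq_mul, mul_one]
  have hinj : InjOn (coneMap Z) {0}ᶜ := by
    intro y hy y' hy' he
    have hnorm : ‖y‖ = ‖y'‖ := by rw [← hgcone y, ← hgcone y', he]
    simp only [coneMap] at he
    rw [hnorm] at he
    have h1 := hZinj (smul_right_injective _ (norm_ne_zero_iff.2 hy') he)
    rw [← norm_smul_radialProj y, ← norm_smul_radialProj y', hnorm, h1]
  have hpos : ∀ q, 0 < gauge C q ↔ q ≠ 0 := fun q => gauge_pos (absorbent_nhds_zero hC0) hCb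
  have himg : coneMap Z '' {y | ‖y‖ ∈ Ioo (0 : ℝ) 1 ∧ radialProj y ∈ univ}
      = interior C \ {0} := by
    ext q
    simp only [mem_image, mem_ofPred_eq, mem_univ, and_true, mem_sdiff, mem_singleton_iff]
    rw [← gauge_lt_one_iff_mem_interior hCconv hC0, ← ne_eq, ← hpos]
    constructor
    · rintro ⟨y, hy, rfl⟩
      rw [hgcone]
      exact hy.symm
    · rintro ⟨h1, h0⟩
      have hf : gauge C ((gauge C q)⁻¹ • q) = 1 := by
        rw [gauge_smul_of_nonneg (inv_nonneg.2 h0.le), smul_eq_mul, inv_mul_cancel₀ h0.ne']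
      rw [gauge_eq_one_iff_mem_frontier hCconv hC0, hCf] at hf
      obtain ⟨x, hx⟩ := hf
      refine ⟨gauge C q • (x : Space n), ?_, ?_⟩
      · rw [norm_smul, norm_coe, mul_one, Real.norm_of_nonneg h0.le]
        exact ⟨h0, h1⟩
      · rw [coneMap_smul Z x h0, hx, smul_smul, mul_inv_cancel₀ h0.ne', one_smul]
  have hvol : volume (interior C \ {0}) = volume (enclosedBody Y) := by
    rw [measure_sdiff_null (measure_singleton _)]
    have h1 : volume (interior C) = volume C := by
      refine measure_congr ?_
      exact interior_ae_eq_of_null_frontier (hCconv.addHaar_frontier volume)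
    rw [h1]
    exact measure_preimage_add_right volume c _
  have hfd : ∀ x, sphereFDeriv Z x = sphereFDeriv Y x := fun x =>
    fderiv_sub_const (f := Y ∘ radialProj) c
  have hZd : ∀ x : USphere n, DifferentiableAt ℝ (Z ∘ radialProj) (x : Space n) := fun x =>
    (h.embedding.differentiableAt (coe_ne_zero x)).sub_const c
  have hv := volume_image_coneMap hZd hinj MeasurableSet.univ
  rw [himg, hvol] at hv
  have hnn : ∀ x, 0 ≤ ⟪Y x - c, (ν x : Space n)⟫ := fun x => by
    have := h.outwardNormal.outward x c (interior_subset hc)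
    rw [← neg_sub, inner_neg_left] at this
    linarith
  have hint : ∀ x, |(augment (sphereFDeriv Z x) (Z x) (x : Space n)).det|
      = ⟪Y x - c, (ν x : Space n)⟫ * areaDensity Y x := fun x => by
    rw [hfd, det_augment_eq_inner_mul (norm_coe x) (norm_coe (ν x)) (h.embedding.sphereFDeriv_self x)
      (h.outwardNormal.inner_sphereFDeriv h.embedding x)
      (fun y hy => h.embedding.eq_zero_of_sphereFDeriv_eq_zero x hy), abs_mul,
      areaDensity_eq h.embedding h.outwardNormal, abs_of_nonneg (hnn x)]
    rfl
  have hcont : Continuous fun x => ⟪Y x - c, (ν x : Space n)⟫ * areaDensity Y x :=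
    ((h.continuous.sub continuous_const).inner
      (continuous_subtype_val.comp (h.continuous_normal hn))).mul (h.continuous_areaDensity hn)
  rw [enclosedVolume, Measure.real, hv, ENNReal.toReal_mul, ENNReal.toReal_ofReal (by positivity),
    mul_comm, Measure.restrict_univ, integral_eq_lintegral_of_nonneg_ae
      (Filter.Eventually.of_forall fun x => mul_nonneg (hnn x) (areaDensity_nonneg x))
      hcont.aestronglyMeasurable]
  simp only [hint]

/-- Comparing the formulas based at the interior points `c` and `c + ε b`, where `b = ∫ ν dA`, gives
`ε ⟪b, b⟫ = 0`. -/
theorem IsStrictlyConvex.enclosedVolume_eq (h : IsStrictlyConvex Y ν) (hn : 1 ≤ n)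
    (x : USphere n) :
    enclosedVolume Y = 1 / ((n : ℝ) + 1) *
      ∫ x, ⟪Y x, (ν x : Space n)⟫ * areaDensity Y x ∂(sphereMeasure n) := by
  have hν := continuous_subtype_val.comp (h.continuous_normal hn)
  have hint : ∀ {E : Type} [NormedAddCommGroup E] {f : USphere n → E}, Continuous f →
      Integrable f (sphereMeasure n) := fun hf =>
    hf.integrable_of_hasCompactSupport (HasCompactSupport.of_compactSpace _)
  have hbi : Integrable (fun x => areaDensity Y x • (ν x : Space n)) (sphereMeasure n) :=
    hint ((h.continuous_areaDensity hn).smul hν)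
  set b := ∫ x, areaDensity Y x • (ν x : Space n) ∂(sphereMeasure n) with hb
  set I := ∫ x, ⟪Y x, (ν x : Space n)⟫ * areaDensity Y x ∂(sphereMeasure n) with hI
  have key : ∀ c ∈ interior (enclosedBody Y),
      enclosedVolume Y = 1 / ((n : ℝ) + 1) * (I - ⟪c, b⟫) := by
    intro c hc
    have hi1 : Integrable (fun x => ⟪Y x, (ν x : Space n)⟫ * areaDensity Y x) (sphereMeasure n) :=
      hint ((h.continuous.inner hν).mul (h.continuous_areaDensity hn))
    have hi2 : Integrable (fun x => ⟪c, areaDensity Y x • (ν x : Space n)⟫) (sphereMeasure n) :=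
      hbi.const_inner c
    rw [h.enclosedVolume_eq_of_mem_interior hn hc, hI, hb, ← integral_inner hbi,
      ← integral_sub hi1 hi2]
    congr 1
    refine integral_congr_ae (Filter.Eventually.of_forall fun x => ?_)
    simp only [inner_sub_left, inner_smul_right]
    ring
  obtain ⟨c, hc⟩ := h.interior_nonempty hn x
  have hcont : Continuous fun ε : ℝ => c + ε • b := by fun_prop
  have h0 : (fun ε : ℝ => c + ε • b) 0 ∈ interior (enclosedBody Y) := by simpa using hc
  have hev := (hcont.continuousAt.eventually (isOpen_interior.mem_nhds h0)).filter_mono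
    (nhdsWithin_le_nhds (s := Ioi 0))
  obtain ⟨ε, hε, hε0⟩ := (hev.and self_mem_nhdsWithin).exists
  have hε0 : 0 < ε := hε0
  have h1 := key c hc
  have h2 := key _ hε
  have hpos : (0 : ℝ) < 1 / ((n : ℝ) + 1) := by positivity
  have h3 := mul_left_cancel₀ hpos.ne' (h1.symm.trans h2)
  rw [inner_add_left, real_inner_smul_left] at h3
  have hbb : ⟪b, b⟫ = 0 := by
    have : ε * ⟪b, b⟫ = 0 := by linarith
    exact (mul_eq_zero.1 this).resolve_left hε0.ne'
  rw [inner_self_eq_zero] at hbb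
  rw [h1, hbb, inner_zero_right, sub_zero]

theorem gaussInv_apply (hν : Function.Injective ν) (x : USphere n) : gaussInv ν (ν x) = x :=
  have : Nonempty (USphere n) := ⟨x⟩
  Function.leftInverse_invFun hν x

theorem IsStrictlyConvex.enclosedVolume_eq_integral_normal (h : IsStrictlyConvex Y ν) (hn : 1 ≤ n)
    (x : USphere n) :
    enclosedVolume Y = 1 / ((n : ℝ) + 1) *
      ∫ z, supportFunction Y ν z / curvatureAtNormal Y ν z ∂(sphereMeasure n) := by
  rw [h.enclosedVolume_eq hn x, h.integral_normal hn
    (fun z => supportFunction Y ν z / curvatureAtNormal Y ν z)]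
  congr 1
  refine integral_congr_ae (Filter.Eventually.of_forall fun x => ?_)
  have hinv : gaussInv ν (ν x) = x := gaussInv_apply (h.injective_normal hn) x
  simp only [supportFunction, curvatureAtNormal, hinv]
  have := (h.gaussCurvature_pos x).ne'
  rw [real_inner_comm]
  field_simp

theorem IsStrictlyConvex.integral_curvatureAtNormal_rpow (h : IsStrictlyConvex Y ν) (hn : 1 ≤ n)
    (α : ℝ) :
    ∫ z, curvatureAtNormal Y ν z ^ (α - 1) ∂(sphereMeasure n) =
      ∫ x, gaussCurvature Y ν x ^ α * areaDensity Y x ∂(sphereMeasure n) := by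
  rw [h.integral_normal hn (fun z => curvatureAtNormal Y ν z ^ (α - 1))]
  refine integral_congr_ae (Filter.Eventually.of_forall fun x => ?_)
  have hinv : gaussInv ν (ν x) = x := gaussInv_apply (h.injective_normal hn) x
  simp only [curvatureAtNormal, hinv]
  have := h.gaussCurvature_pos x
  rw [Real.rpow_sub_one this.ne']
  field_simp

end Volume

/-! ### Strict separation from the enclosed body -/

section Separation

variable {Y : USphere n → Space n} {ν : USphere n → USphere n}

theorem inner_lt_of_mem_enclosedBody {z p : Space n} {c : ℝ} (hp : p ∈ enclosedBody Y)
    (hc : ∀ y, ⟪Y y, z⟫ < c) : ⟪p, z⟫ < c := by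
  have hconv : Convex ℝ {q : Space n | ⟪q, z⟫ < c} :=
    convex_halfSpace_lt ⟨fun a b => inner_add_left _ _ _, fun a b => real_inner_smul_left _ _ _⟩ c
  exact convexHull_min (range_subset_iff.2 hc) hconv hp

theorem IsStrictlyConvex.exists_inner_lt_of_notMem (h : IsStrictlyConvex Y ν) {p : Space n}
    (hp : p ∉ enclosedBody Y) : ∃ z : USphere n, ∀ y, ⟪Y y, (z : Space n)⟫ < ⟪p, (z : Space n)⟫ := by
  obtain ⟨f, u, hf, hu⟩ := geometric_hahn_banach_closed_point (convex_enclosedBody Y)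
    h.isClosed_enclosedBody hp
  set w := (InnerProductSpace.toDual ℝ (Space n)).symm f with hw
  have hfw : ∀ q, f q = ⟪q, w⟫ := fun q => by
    rw [real_inner_comm, hw, InnerProductSpace.toDual_symm_apply]
  have hlt : ∀ y, ⟪Y y, w⟫ < ⟪p, w⟫ := fun y => by
    rw [← hfw, ← hfw]
    exact (hf _ (mem_enclosedBody Y y)).trans hu
  have hw0 : w ≠ 0 := by
    intro h0
    simpa [h0] using hlt (radialProj 0)
  refine ⟨radialProj w, fun y => ?_⟩
  rw [coe_radialProj hw0, inner_smul_right, inner_smul_right]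
  exact mul_lt_mul_of_pos_left (hlt y) (inv_pos.2 (norm_pos_iff.2 hw0))

end Separation

/-! ### Strict nesting of the evolving bodies -/

section Nesting

variable {α T : ℝ} {X : ℝ → USphere n → Space n} {ν : ℝ → USphere n → USphere n}

theorem IsSolution.continuousOn (hX : IsSolution α T X ν) :
    ContinuousOn (fun p : USphere n × ℝ => X p.2 p.1) (univ ×ˢ Ico 0 T) :=
  hX.smooth.continuousOn

/-- The maximum of `⟪X τ y, z⟫` over space and `[t, s]` occurs only at `τ = t`: at a maximum `z` is
the normal, so the time derivative is `-K ^ α < 0`, and an earlier time would give a larger value.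
-/
theorem IsSolution.support_lt (hX : IsSolution α T X ν) (hn : 1 ≤ n) {t s : ℝ} (ht : 0 ≤ t)
    (hts : t < s) (hs : s < T) (z : USphere n) :
    ∃ y₀, ∀ y, ⟪X s y, (z : Space n)⟫ < ⟪X t y₀, (z : Space n)⟫ := by
  have hsub : Icc t s ⊆ Ico 0 T := fun τ hτ => ⟨ht.trans hτ.1, hτ.2.trans_lt hs⟩
  have hcont : ContinuousOn (fun p : USphere n × ℝ => ⟪X p.2 p.1, (z : Space n)⟫)
      (univ ×ˢ Icc t s) :=
    (hX.continuousOn.mono (prod_mono_right hsub)).inner continuousOn_const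
  obtain ⟨⟨y₀, c⟩, hc, hmax⟩ := (isCompact_univ.prod isCompact_Icc).exists_isMaxOn
    ⟨(z, t), mem_univ z, left_mem_Icc.2 hts.le⟩ hcont
  have hmax' : ∀ y, ∀ τ ∈ Icc t s, ⟪X τ y, (z : Space n)⟫ ≤ ⟪X c y₀, (z : Space n)⟫ :=
    fun y τ hτ => hmax (show (y, τ) ∈ univ ×ˢ Icc t s from ⟨mem_univ y, hτ⟩)
  have key : ∀ y, ∀ c ∈ Icc t s,
      (∀ y', ∀ τ ∈ Icc t s, ⟪X τ y', (z : Space n)⟫ ≤ ⟪X c y, (z : Space n)⟫) → c = t := by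
    intro y c hc hm
    by_contra hne
    have htc : t < c := lt_of_le_of_ne hc.1 (Ne.symm hne)
    have hconv := hX.strictlyConvex c (hsub hc)
    have hνz : ν c y = z := hconv.normal_eq_of_support hn fun y' => by
      rw [inner_sub_left]
      linarith [hm y' c hc]
    have hIcc : Icc t c ⊆ Ico 0 T := (Icc_subset_Icc_right hc.2).trans hsub
    have hd : HasDerivWithinAt (fun τ => ⟪X τ y, (z : Space n)⟫)
        (-(gaussCurvature (X c) (ν c) y ^ α)) (Icc t c) c := by
      have h1 := ((hX.flow c (hsub hc) y).mono hIcc).inner ℝ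
        (hasDerivWithinAt_const c (Icc t c) (z : Space n))
      refine h1.congr_deriv ?_
      rw [hνz, inner_zero_right, zero_add, real_inner_smul_left, inner_coe_self, mul_one]
    have hloc : IsLocalMaxOn (fun τ => ⟪X τ y, (z : Space n)⟫) (Icc t c) c := by
      filter_upwards [self_mem_nhdsWithin] with τ hτ
      exact hm y τ ⟨hτ.1, hτ.2.trans hc.2⟩
    -- Only the backward direction is used, so `c = s` is covered as well.
    have htan : t - c ∈ posTangentConeAt (Icc t c) c :=
      sub_mem_posTangentConeAt_of_segment_subset (by rw [segment_symm, segment_eq_Icc htc.le])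
    have hle := hloc.hasFDerivWithinAt_nonpos hd.hasFDerivWithinAt htan
    have hK : 0 < gaussCurvature (X c) (ν c) y ^ α :=
      Real.rpow_pos_of_pos (hconv.gaussCurvature_pos y) α
    simp at hle
    nlinarith
  have hct := key y₀ c hc.2 hmax'
  subst hct
  refine ⟨y₀, fun y => lt_of_le_of_ne (hmax' y s (right_mem_Icc.2 hts.le)) fun he => ?_⟩
  -- Equality would make `(y, s)` another maximum, forcing `s = t`.
  exact hts.ne' (key y s (right_mem_Icc.2 hts.le) fun y' τ hτ => he ▸ hmax' y' τ hτ)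

theorem IsSolution.notMem_enclosedBody (hX : IsSolution α T X ν) (hn : 1 ≤ n) {t s : ℝ}
    (ht : 0 ≤ t) (hts : t < s) (hs : s < T) (x : USphere n) : X t x ∉ enclosedBody (X s) := by
  intro hx
  obtain ⟨y₀, hy₀⟩ := hX.support_lt hn ht hts hs (ν t x)
  have h1 := inner_lt_of_mem_enclosedBody hx hy₀
  have h2 := (hX.strictlyConvex t ⟨ht, hts.trans hs⟩).outwardNormal.outward x _
    (mem_enclosedBody (X t) y₀)
  rw [inner_sub_left] at h2
  linarith

theorem IsSolution.enclosedBody_subset (hX : IsSolution α T X ν) (hn : 1 ≤ n) {t s : ℝ}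
    (ht : 0 ≤ t) (hts : t ≤ s) (hs : s < T) : enclosedBody (X s) ⊆ enclosedBody (X t) := by
  rcases hts.eq_or_lt with rfl | hts
  · exact Subset.rfl
  intro p hp
  by_contra hpt
  obtain ⟨z, hz⟩ := (hX.strictlyConvex t ⟨ht, hts.trans hs⟩).exists_inner_lt_of_notMem hpt
  obtain ⟨y₀, hy₀⟩ := hX.support_lt hn ht hts hs z
  exact lt_asymm (inner_lt_of_mem_enclosedBody hp hy₀) (hz y₀)

theorem IsSolution.injOn (hX : IsSolution α T X ν) (hn : 1 ≤ n) {τ τ' : ℝ} (hτ : τ ∈ Ico 0 T)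
    (hτ' : τ' ∈ Ico 0 T) {x x' : USphere n} (h : X τ x = X τ' x') : τ = τ' ∧ x = x' := by
  have htau : τ = τ' := by
    rcases lt_trichotomy τ τ' with hlt | heq | hlt
    · exact absurd (h ▸ mem_enclosedBody (X τ') x')
        (hX.notMem_enclosedBody hn hτ.1 hlt hτ'.2 x)
    · exact heq
    · exact absurd (h ▸ mem_enclosedBody (X τ) x)
        (hX.notMem_enclosedBody hn hτ'.1 hlt hτ.2 x')
  subst htau
  exact ⟨rfl, (hX.strictlyConvex τ hτ).embedding.injective h⟩

/-- A tube lemma: compactness of the sphere makes the strict inequality uniform in `y` near `t`. -/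
theorem eventually_forall_of_continuousOn {f : USphere n × ℝ → ℝ} {t c : ℝ} {I : Set ℝ}
    (hf : ContinuousOn f (univ ×ˢ I)) (ht : t ∈ I) (h : ∀ y, f (y, t) < c) :
    ∀ᶠ τ in nhdsWithin t I, ∀ y, f (y, τ) < c := by
  have hk := isCompact_univ (X := USphere n)
  have := hk.eventually_forall_of_forall_eventually (x₀ := (⟨t, ht⟩ : I))
    (P := fun τ y => f (y, τ) < c) (fun y _ => by
      have hc : Continuous fun q : I × USphere n => f (q.2, q.1) :=
        hf.comp_continuous (by fun_prop) fun q => ⟨mem_univ _, q.1.2⟩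
      exact hc.continuousAt.eventually_lt_const (h y))
  rw [nhdsWithin_eq_map_subtype_coe ht, Filter.eventually_map]
  simpa using this

/-- The region between `Σ_t` and `Σ_s` is swept out by the flow. -/
theorem IsSolution.exists_eq_of_mem (hX : IsSolution α T X ν) {t s : ℝ} (ht : 0 ≤ t)
    (hts : t ≤ s) (hs : s < T) {p : Space n} (hpt : p ∈ enclosedBody (X t))
    (hps : p ∉ enclosedBody (X s)) : ∃ τ ∈ Ico t s, ∃ x, X τ x = p := by
  have hsub : Icc t s ⊆ Ico 0 T := fun τ hτ => ⟨ht.trans hτ.1, hτ.2.trans_lt hs⟩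
  -- The witness is the last time at which `p` is still enclosed; `Q` is closed because strict
  -- separation persists for nearby times.
  let Q : Set ℝ := {τ ∈ Icc t s | p ∈ enclosedBody (X τ)}
  have hQ : IsClosed Q := by
    rw [← isOpen_compl_iff, isOpen_iff_mem_nhds]
    intro τ hτ
    by_cases hτI : τ ∈ Icc t s
    · have hp : p ∉ enclosedBody (X τ) := fun hp => hτ ⟨hτI, hp⟩
      obtain ⟨z, hz⟩ := (hX.strictlyConvex τ (hsub hτI)).exists_inner_lt_of_notMem hp
      have hev := eventually_forall_of_continuousOn
        ((hX.continuousOn.mono (prod_mono_right hsub)).inner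
          (continuousOn_const (c := (z : Space n)))) hτI hz
      rw [eventually_nhdsWithin_iff] at hev
      filter_upwards [hev] with σ hσ hσQ
      exact lt_irrefl _ (inner_lt_of_mem_enclosedBody hσQ.2 (hσ hσQ.1))
    · filter_upwards [isClosed_Icc.isOpen_compl.mem_nhds hτI] with σ hσ hσQ
      exact hσ hσQ.1
  have hQc : IsCompact Q := isCompact_Icc.of_isClosed_subset hQ fun τ hτ => hτ.1
  obtain ⟨τ, hτQ, hτmax⟩ := hQc.exists_isGreatest ⟨t, left_mem_Icc.2 hts, hpt⟩
  have hτs : τ < s := lt_of_le_of_ne hτQ.1.2 fun he => hps (he ▸ hτQ.2)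
  have hconv := hX.strictlyConvex τ (hsub hτQ.1)
  refine ⟨τ, ⟨hτQ.1.1, hτs⟩, ?_⟩
  show p ∈ range (X τ)
  rw [← hconv.boundary]
  refine ⟨subset_closure hτQ.2, fun hint => ?_⟩
  -- If a ball about `p` were enclosed at time `τ`, then shortly afterwards, with points moved by
  -- less than `ε / 2`, no hyperplane could yet separate `p`, against the maximality of `τ`.
  obtain ⟨ε, hε, hball⟩ := Metric.mem_nhds_iff.1 (mem_interior_iff_mem_nhds.1 hint)
  have hcont : ContinuousOn (fun q : USphere n × ℝ => ‖X q.2 q.1 - X τ q.1‖) (univ ×ˢ Icc t s) :=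
    ((hX.continuousOn.mono (prod_mono_right hsub)).sub
      (hconv.continuous.comp continuous_fst).continuousOn).norm
  have hev := (eventually_forall_of_continuousOn hcont hτQ.1
    (c := ε / 2) (fun y => by simpa using hε)).filter_mono
    (nhdsWithin_mono τ (Ioc_subset_Icc_self.trans (Icc_subset_Icc_left hτQ.1.1)))
  have : (nhdsWithin τ (Ioc τ s)).NeBot := by
    rw [nhdsWithin_Ioc_eq_nhdsGT hτs]; infer_instance
  obtain ⟨σ, hσ, hσI⟩ := (hev.and self_mem_nhdsWithin).exists
  have hσI' : σ ∈ Icc t s := ⟨hτQ.1.1.trans hσI.1.le, hσI.2⟩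
  have hσp : p ∉ enclosedBody (X σ) := fun hp => not_le.2 hσI.1 (hτmax ⟨hσI', hp⟩)
  obtain ⟨z, hz⟩ := (hX.strictlyConvex σ (hsub hσI')).exists_inner_lt_of_notMem hσp
  have hmem : p + (ε / 2) • (z : Space n) ∈ enclosedBody (X τ) := by
    refine hball ?_
    rw [Metric.mem_ball, dist_eq_norm, add_sub_cancel_left, norm_smul, norm_coe, mul_one,
      Real.norm_of_nonneg (by positivity)]
    linarith
  refine lt_irrefl _ (inner_lt_of_mem_enclosedBody hmem (z := (z : Space n)) fun y => ?_)
  rw [inner_add_left, real_inner_smul_left, inner_coe_self, mul_one]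
  have h1 : ⟪X τ y - X σ y, (z : Space n)⟫ ≤ ε / 2 := by
    refine (real_inner_le_norm _ _).trans ?_
    rw [norm_coe, mul_one, norm_sub_rev]
    exact (hσ y).le
  rw [inner_sub_left] at h1
  linarith [hz y]

end Nesting

/-! ### The sweep map and the rate of volume loss -/

section Sweep

variable {α T : ℝ} {X : ℝ → USphere n → Space n} {ν : ℝ → USphere n → USphere n}

/-- The space-time map `X`, extended homogeneously of degree zero in space. -/
noncomputable def spaceTime (X : ℝ → USphere n → Space n) (p : Space n × ℝ) : Space n :=
  X p.2 (radialProj p.1)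

theorem IsSolution.contDiffOn_spaceTime (hX : IsSolution α T X ν) :
    ContDiffOn ℝ ∞ (spaceTime X) ({0}ᶜ ×ˢ Ico 0 T) := by
  rw [← contMDiffOn_iff_contDiffOn]
  have h1 : ContMDiffOn 𝓘(ℝ, Space n × ℝ) (𝓡 n) ∞
      (fun p : Space n × ℝ => radialProj p.1) ({0}ᶜ ×ˢ Ico 0 T) :=
    contMDiffOn_radialProj.comp contDiff_fst.contMDiff.contMDiffOn fun p hp => hp.1
  have h2 : ContMDiffOn 𝓘(ℝ, Space n × ℝ) 𝓘(ℝ, ℝ) ∞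
      (fun p : Space n × ℝ => p.2) ({0}ᶜ ×ˢ Ico 0 T) :=
    contDiff_snd.contMDiff.contMDiffOn
  exact hX.smooth.comp (h1.prodMk h2) fun p hp => ⟨mem_univ _, hp.2⟩

theorem uniqueDiffOn_spaceTime (n : ℕ) (T : ℝ) :
    UniqueDiffOn ℝ (({0}ᶜ : Set (Space n)) ×ˢ Ico 0 T) :=
  isOpen_compl_singleton.uniqueDiffOn.prod (uniqueDiffOn_Ico 0 T)

/-- The space-time derivative of `X`. -/
noncomputable def spaceTimeDeriv (T : ℝ) (X : ℝ → USphere n → Space n) (p : Space n × ℝ) :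
    Space n × ℝ →L[ℝ] Space n :=
  fderivWithin ℝ (spaceTime X) ({0}ᶜ ×ˢ Ico 0 T) p

theorem IsSolution.hasFDerivWithinAt_spaceTime (hX : IsSolution α T X ν) {y : Space n} (hy : y ≠ 0)
    {t : ℝ} (ht : t ∈ Ico 0 T) :
    HasFDerivWithinAt (spaceTime X) (spaceTimeDeriv T X (y, t)) ({0}ᶜ ×ˢ Ico 0 T) (y, t) :=
  ((hX.contDiffOn_spaceTime.differentiableOn (by simp)) (y, t) ⟨hy, ht⟩).hasFDerivWithinAt

theorem IsSolution.continuousOn_spaceTimeDeriv (hX : IsSolution α T X ν) :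
    ContinuousOn (spaceTimeDeriv T X) ({0}ᶜ ×ˢ Ico 0 T) :=
  hX.contDiffOn_spaceTime.continuousOn_fderivWithin (uniqueDiffOn_spaceTime n T) (by simp)

theorem IsSolution.spaceTimeDeriv_inl (hX : IsSolution α T X ν) (x : USphere n) {r : ℝ}
    (hr : 0 < r) {t : ℝ} (ht : t ∈ Ico 0 T) :
    spaceTimeDeriv T X (r • (x : Space n), t) ∘L ContinuousLinearMap.inl ℝ (Space n) ℝ
      = r⁻¹ • sphereFDeriv (X t) x := by
  have hne := smul_ne_zero hr.ne' (coe_ne_zero x)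
  have h1 := (hX.hasFDerivWithinAt_spaceTime hne ht).comp (r • (x : Space n))
    ((hasFDerivAt_prodMk_left (𝕜 := ℝ) (r • (x : Space n)) t).hasFDerivWithinAt (s := {0}ᶜ))
    (show MapsTo (fun y : Space n => (y, t)) {0}ᶜ ({0}ᶜ ×ˢ Ico 0 T) from fun y hy => ⟨hy, ht⟩)
  exact (h1.hasFDerivAt (isOpen_ne.mem_nhds hne)).unique (hasFDerivAt_comp_radialProj
    ((hX.strictlyConvex t ht).embedding.differentiableAt (coe_ne_zero x)) hr)

theorem IsSolution.spaceTimeDeriv_inr (hX : IsSolution α T X ν) (x : USphere n) {r : ℝ}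
    (hr : 0 < r) {t : ℝ} (ht : t ∈ Ico 0 T) :
    spaceTimeDeriv T X (r • (x : Space n), t) (0, 1)
      = -(gaussCurvature (X t) (ν t) x ^ α) • (ν t x : Space n) := by
  have hne := smul_ne_zero hr.ne' (coe_ne_zero x)
  have h1 := (hX.hasFDerivWithinAt_spaceTime hne ht).comp_hasDerivWithinAt t
    ((hasDerivAt_const t (r • (x : Space n))).prodMk (hasDerivAt_id t)).hasDerivWithinAt
    (s := Ico 0 T) (fun s hs => ⟨hne, hs⟩)
  have h2 := hX.flow t ht x
  have heq : spaceTime X ∘ Prod.mk (r • (x : Space n)) = fun s => X s x := by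
    funext s
    simp [spaceTime, radialProj_smul x hr]
  rw [heq] at h1
  exact (uniqueDiffOn_Ico 0 T t ht).eq_deriv _ h1 h2

theorem IsSolution.abs_det_augment (hX : IsSolution α T X ν) (x : USphere n) {t : ℝ}
    (ht : t ∈ Ico 0 T) :
    |(augment (sphereFDeriv (X t) x) (-(gaussCurvature (X t) (ν t) x ^ α) • (ν t x : Space n))
      (x : Space n)).det| = gaussCurvature (X t) (ν t) x ^ α * areaDensity (X t) x := by
  have h := hX.strictlyConvex t ht
  rw [det_augment_eq_inner_mul (norm_coe x) (norm_coe (ν t x)) (h.embedding.sphereFDeriv_self x)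
    (h.outwardNormal.inner_sphereFDeriv h.embedding x)
    (fun y hy => h.embedding.eq_zero_of_sphereFDeriv_eq_zero x hy), abs_mul,
    areaDensity_eq h.embedding h.outwardNormal, real_inner_smul_left, inner_coe_self, mul_one,
    abs_neg, abs_of_pos (Real.rpow_pos_of_pos (h.gaussCurvature_pos x) α)]
  rfl

/-- The integrand is the absolute determinant built from the first space-time derivatives of `X`
alone, so no continuity of `ν` or `K` in time is needed. -/
theorem IsSolution.continuousOn_speed_mul_areaDensity (hX : IsSolution α T X ν) :
    ContinuousOn (fun p : ℝ × USphere n =>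
      gaussCurvature (X p.1) (ν p.1) p.2 ^ α * areaDensity (X p.1) p.2) (Ico 0 T ×ˢ univ) := by
  have h1 : ContinuousOn (fun p : ℝ × USphere n => spaceTimeDeriv T X ((p.2 : Space n), p.1))
      (Ico 0 T ×ˢ univ) :=
    hX.continuousOn_spaceTimeDeriv.comp (by fun_prop) fun p hp => ⟨coe_ne_zero p.2, hp.1⟩
  have h2 : ContinuousOn (fun p : ℝ × USphere n =>
      |(augment (spaceTimeDeriv T X ((p.2 : Space n), p.1) ∘L ContinuousLinearMap.inl ℝ (Space n) ℝ)
        (spaceTimeDeriv T X ((p.2 : Space n), p.1) (0, 1)) (p.2 : Space n)).det|)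
      (Ico 0 T ×ˢ univ) := by
    refine (ContinuousLinearMap.continuous_det.comp_continuousOn
      (continuous_augment.comp_continuousOn (ContinuousOn.prodMk ?_ (ContinuousOn.prodMk ?_ ?_)))).abs
    · exact h1.clm_comp continuousOn_const
    · exact h1.clm_apply continuousOn_const
    · fun_prop
  refine h2.congr fun p hp => ?_
  have hl := hX.spaceTimeDeriv_inl p.2 one_pos hp.1
  have hr := hX.spaceTimeDeriv_inr p.2 one_pos hp.1
  rw [one_smul] at hl hr
  simp only [hl, hr, inv_one, one_smul]
  exact (hX.abs_det_augment p.2 hp.1).symm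

/-- The map that sends the sphere of radius `r` to `Σ_r`. -/
noncomputable def sweepMap (X : ℝ → USphere n → Space n) (y : Space n) : Space n :=
  spaceTime X (y, ‖y‖)

theorem sweepMap_smul (X : ℝ → USphere n → Space n) (x : USphere n) {r : ℝ} (hr : 0 < r) :
    sweepMap X (r • (x : Space n)) = X r x := by
  rw [sweepMap, spaceTime, radialProj_smul x hr, norm_smul, norm_coe, mul_one,
    Real.norm_of_nonneg hr.le]

theorem IsSolution.hasFDerivAt_sweepMap (hX : IsSolution α T X ν) (x : USphere n) {r : ℝ}
    (hr : r ∈ Ioo 0 T) :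
    HasFDerivAt (sweepMap X) (augment (r⁻¹ • sphereFDeriv (X r) x)
      (-(gaussCurvature (X r) (ν r) x ^ α) • (ν r x : Space n)) (x : Space n))
      (r • (x : Space n)) := by
  have hne := smul_ne_zero hr.1.ne' (coe_ne_zero x)
  have hr' : r ∈ Ico 0 T := ⟨hr.1.le, hr.2⟩
  have hnorm : ‖r • (x : Space n)‖ = r := by
    rw [norm_smul, norm_coe, mul_one, Real.norm_of_nonneg hr.1.le]
  have h1 : HasFDerivAt (spaceTime X) (spaceTimeDeriv T X (r • (x : Space n), r))
      (r • (x : Space n), ‖r • (x : Space n)‖) := by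
    rw [hnorm]
    exact (hX.hasFDerivWithinAt_spaceTime hne hr').hasFDerivAt
      (prod_mem_nhds (isOpen_ne.mem_nhds hne) (Ico_mem_nhds hr.1 hr.2))
  have h2 := h1.comp (r • (x : Space n))
    ((hasFDerivAt_id (r • (x : Space n))).prodMk (hasFDerivAt_norm_smul_coe x hr.1))
  refine h2.congr_fderiv ?_
  ext1 v
  rw [← hX.spaceTimeDeriv_inl x hr.1 hr', ← hX.spaceTimeDeriv_inr x hr.1 hr', augment_apply,
    ContinuousLinearMap.comp_apply, ContinuousLinearMap.comp_apply, ← map_smul, ← map_add]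
  congr 1
  ext1 <;> simp

/-- The spatial derivative at radius `r` carries a factor `r⁻¹`, and the resulting `r⁻¹ ^ n` cancels
the polar weight `r ^ n`. -/
theorem IsSolution.volume_image_sweepMap (hX : IsSolution α T X ν) (hn : 1 ≤ n) {t s : ℝ}
    (ht : 0 ≤ t) (hs : s < T) :
    volume (sweepMap X '' {y | ‖y‖ ∈ Ioo t s}) = ∫⁻ r in Ioo t s, ∫⁻ x,
      ENNReal.ofReal (gaussCurvature (X r) (ν r) x ^ α * areaDensity (X r) x)
        ∂(sphereMeasure n) := by
  have hm : MeasurableSet {y : Space n | ‖y‖ ∈ Ioo t s} := measurable_norm measurableSet_Ioo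
  have hsub : ∀ r ∈ Ioo t s, r ∈ Ioo 0 T := fun r hr => ⟨ht.trans_lt hr.1, hr.2.trans hs⟩
  have hderiv : ∀ y ∈ {y : Space n | ‖y‖ ∈ Ioo t s},
      HasFDerivWithinAt (sweepMap X) (fderiv ℝ (sweepMap X) y) {y | ‖y‖ ∈ Ioo t s} y := by
    intro y hy
    have := hX.hasFDerivAt_sweepMap (radialProj y) (hsub _ hy)
    rw [norm_smul_radialProj] at this
    exact this.differentiableAt.hasFDerivAt.hasFDerivWithinAt
  have hinj : InjOn (sweepMap X) {y | ‖y‖ ∈ Ioo t s} := by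
    intro y hy y' hy' he
    obtain ⟨h1, h2⟩ := hX.injOn hn ⟨(hsub _ hy).1.le, (hsub _ hy).2⟩
      ⟨(hsub _ hy').1.le, (hsub _ hy').2⟩ he
    rw [← norm_smul_radialProj y, ← norm_smul_radialProj y', h2]
    exact congrArg (fun c => c • _) h1
  rw [← lintegral_abs_det_fderiv_eq_addHaar_image volume hm hderiv hinj,
    setLIntegral_eq_lintegral_polar (measurable_det_fderiv _) measurableSet_Ioo
      (fun r hr => (hsub r hr).1)]
  refine setLIntegral_congr_fun measurableSet_Ioo fun r hr => ?_
  have hr0 := (hsub r hr).1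
  have hmeas : Measurable fun x : USphere n =>
      ENNReal.ofReal |(fderiv ℝ (sweepMap X) (r • (x : Space n))).det| :=
    (measurable_det_fderiv (sweepMap X)).comp (by fun_prop)
  rw [← lintegral_mul_const _ hmeas]
  refine lintegral_congr fun x => ?_
  have hrT : r ∈ Ico 0 T := ⟨hr0.le, (hsub r hr).2⟩
  rw [(hX.hasFDerivAt_sweepMap x (hsub r hr)).fderiv, ← ENNReal.ofReal_mul (abs_nonneg _),
    ← hX.abs_det_augment x hrT, ← det_augment_smul (norm_coe x)
      ((hX.strictlyConvex r hrT).embedding.sphereFDeriv_self x) _ hr0.ne' (finrank_space n),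
    abs_mul, abs_of_pos (pow_pos hr0 n)]

/-- The rate at which volume is lost. -/
noncomputable def volumeRate (α : ℝ) (X : ℝ → USphere n → Space n)
    (ν : ℝ → USphere n → USphere n) (t : ℝ) : ℝ :=
  ∫ x, gaussCurvature (X t) (ν t) x ^ α * areaDensity (X t) x ∂(sphereMeasure n)

theorem IsSolution.continuousOn_volumeRate (hX : IsSolution α T X ν) :
    ContinuousOn (volumeRate α X ν) (Ico 0 T) :=
  continuousOn_integral_of_compact_support isCompact_univ
    hX.continuousOn_speed_mul_areaDensity fun _ x _ hx => absurd (mem_univ x) hx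

theorem IsSolution.enclosedVolume_sub (hX : IsSolution α T X ν) (hn : 1 ≤ n) {t s : ℝ}
    (ht : 0 ≤ t) (hts : t ≤ s) (hs : s < T) :
    enclosedVolume (X t) - enclosedVolume (X s) = ∫ r in t..s, volumeRate α X ν r := by
  have hsub : ∀ r ∈ Icc t s, r ∈ Ico 0 T := fun r hr => ⟨ht.trans hr.1, hr.2.trans_lt hs⟩
  have hct := hX.strictlyConvex t ⟨ht, hts.trans_lt hs⟩
  have hcs := hX.strictlyConvex s ⟨ht.trans hts, hs⟩
  have hfin : volume (enclosedBody (X t)) ≠ ⊤ :=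
    (isBounded_enclosedBody hct.continuous).measure_lt_top.ne
  have hnonneg : ∀ r ∈ Icc t s, ∀ x,
      0 ≤ gaussCurvature (X r) (ν r) x ^ α * areaDensity (X r) x := fun r hr x =>
    mul_nonneg (Real.rpow_nonneg ((hX.strictlyConvex r (hsub r hr)).gaussCurvature_pos x).le α)
      (areaDensity_nonneg x)
  -- The swept region omits at most the initial hypersurface `τ = t`, a null set as the boundary of
  -- a convex body.
  have hdiff : volume (enclosedBody (X t) \ enclosedBody (X s))
      = volume (sweepMap X '' {y | ‖y‖ ∈ Ioo t s}) := by
    refine le_antisymm ?_ (measure_mono ?_)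
    · calc volume (enclosedBody (X t) \ enclosedBody (X s))
          ≤ volume (sweepMap X '' {y | ‖y‖ ∈ Ioo t s} ∪ frontier (enclosedBody (X t))) := by
            refine measure_mono fun p hp => ?_
            obtain ⟨τ, hτ, x, rfl⟩ := hX.exists_eq_of_mem ht hts hs hp.1 hp.2
            rcases hτ.1.eq_or_lt with rfl | hlt
            · right
              rw [hct.boundary]
              exact mem_range_self x
            · left
              have hτ0 := ht.trans_lt hlt
              refine ⟨τ • (x : Space n), ?_, sweepMap_smul X x hτ0⟩
              rw [mem_ofPred_eq, norm_smul, norm_coe, mul_one, Real.norm_of_nonneg hτ0.le]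
              exact ⟨hlt, hτ.2⟩
        _ ≤ _ := measure_union_le _ _
        _ = _ := by rw [(convex_enclosedBody (X t)).addHaar_frontier volume, add_zero]
    · rintro _ ⟨y, hy, rfl⟩
      exact ⟨hX.enclosedBody_subset hn ht hy.1.le (hy.2.trans hs) (mem_enclosedBody _ _),
        hX.notMem_enclosedBody hn (ht.trans hy.1.le) hy.2 hs _⟩
  have hinner : ∀ r ∈ Ioo t s, ∫⁻ x,
      ENNReal.ofReal (gaussCurvature (X r) (ν r) x ^ α * areaDensity (X r) x) ∂(sphereMeasure n)
        = ENNReal.ofReal (volumeRate α X ν r) := by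
    intro r hr
    have hr' := Ioo_subset_Icc_self hr
    have hc : Continuous fun x => gaussCurvature (X r) (ν r) x ^ α * areaDensity (X r) x :=
      hX.continuousOn_speed_mul_areaDensity.comp_continuous
        (f := fun x : USphere n => (r, x)) (by fun_prop) fun x => ⟨hsub r hr', mem_univ _⟩
    exact (ofReal_integral_eq_lintegral_ofReal
      (hc.integrable_of_hasCompactSupport (HasCompactSupport.of_compactSpace _))
      (Filter.Eventually.of_forall (hnonneg r hr'))).symm
  have hA : ContinuousOn (volumeRate α X ν) (Icc t s) := hX.continuousOn_volumeRate.mono hsub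
  have hint : IntegrableOn (volumeRate α X ν) (Ioc t s) :=
    hA.integrableOn_Icc.mono_set Ioc_subset_Icc_self
  have h0 : ∀ r ∈ Icc t s, 0 ≤ volumeRate α X ν r := fun r hr => integral_nonneg (hnonneg r hr)
  rw [enclosedVolume, enclosedVolume, ← measureReal_sdiff
    (hX.enclosedBody_subset hn ht hts hs) hcs.isClosed_enclosedBody.measurableSet hfin,
    Measure.real, hdiff, hX.volume_image_sweepMap hn ht hs,
    setLIntegral_congr_fun measurableSet_Ioo hinner, intervalIntegral.integral_of_le hts,
    Measure.restrict_congr_set Ioo_ae_eq_Ioc, ← ofReal_integral_eq_lintegral_ofReal hint,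
    ENNReal.toReal_ofReal]
  · exact setIntegral_nonneg measurableSet_Ioc fun r hr => h0 r (Ioc_subset_Icc_self hr)
  · filter_upwards [ae_restrict_mem measurableSet_Ioc] with r hr
    exact h0 r (Ioc_subset_Icc_self hr)

theorem IsSolution.hasDerivWithinAt_enclosedVolume (hX : IsSolution α T X ν) (hn : 1 ≤ n) {t : ℝ}
    (ht : t ∈ Ico 0 T) :
    HasDerivWithinAt (fun s => enclosedVolume (X s)) (-volumeRate α X ν t) (Ico 0 T) t := by
  have heq : ∀ s ∈ Ico 0 T,
      enclosedVolume (X s) = enclosedVolume (X t) - ∫ r in t..s, volumeRate α X ν r := by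
    intro s hs
    rcases le_total t s with hts | hst
    · rw [← hX.enclosedVolume_sub hn ht.1 hts hs.2]; ring
    · rw [intervalIntegral.integral_symm, ← hX.enclosedVolume_sub hn hs.1 hst ht.2]; ring
  -- On `[0, b]` with `t < b < T` the rate is continuous up to both ends, and this interval is a
  -- neighbourhood of `t` within `[0, T)`, `t = 0` included.
  obtain ⟨b, htb, hbT⟩ := exists_between ht.2
  have hsub : Icc 0 b ⊆ Ico 0 T := fun r hr => ⟨hr.1, hr.2.trans_lt hbT⟩
  have htI : t ∈ Icc 0 b := ⟨ht.1, htb.le⟩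
  have : Fact (t ∈ Icc 0 b) := ⟨htI⟩
  have hc : ContinuousOn (volumeRate α X ν) (Icc 0 b) := hX.continuousOn_volumeRate.mono hsub
  have hd : HasDerivWithinAt (fun s => ∫ r in t..s, volumeRate α X ν r) (volumeRate α X ν t)
      (Icc 0 b) t :=
    intervalIntegral.integral_hasDerivWithinAt_right (IntervalIntegrable.refl)
      (hc.stronglyMeasurableAtFilter_nhdsWithin measurableSet_Icc t) (hc t htI)
  have hmem : Icc 0 b ∈ nhdsWithin t (Ico 0 T) := by
    have : Iio b ∈ nhds t := Iio_mem_nhds htb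
    filter_upwards [self_mem_nhdsWithin, mem_nhdsWithin_of_mem_nhds this] with r hr hrb
    exact ⟨hr.1, le_of_lt hrb⟩
  exact ((hd.mono_of_mem_nhdsWithin hmem).const_sub _).congr heq (heq t ht)

end Sweep

end GaussFlow

theorem lemma4p1 (n : ℕ) (hn : 1 ≤ n) (α : ℝ) (hα : 0 < α) (T : ℝ)
    (X : ℝ → GaussFlow.USphere n → GaussFlow.Space n)
    (ν : ℝ → GaussFlow.USphere n → GaussFlow.USphere n)
    (hX : GaussFlow.IsSolution α T X ν) (t : ℝ) (ht : t ∈ Ico 0 T) :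
    -- the Gauss map is a bijection, so that `K` and `S` are functions of the normal `z`
    Function.Bijective (ν t) ∧
    -- the two integral formulas for the enclosed volume
    GaussFlow.enclosedVolume (X t) =
      1 / ((n : ℝ) + 1) * ∫ x, ⟪X t x, (ν t x : GaussFlow.Space n)⟫ *
        GaussFlow.areaDensity (X t) x ∂(GaussFlow.sphereMeasure n) ∧
    GaussFlow.enclosedVolume (X t) =
      1 / ((n : ℝ) + 1) * ∫ z, GaussFlow.supportFunction (X t) (ν t) z /
        GaussFlow.curvatureAtNormal (X t) (ν t) z ∂(GaussFlow.sphereMeasure n) ∧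
    -- the evolution of the enclosed volume
    HasDerivWithinAt (fun s => GaussFlow.enclosedVolume (X s))
      (-∫ z, GaussFlow.curvatureAtNormal (X t) (ν t) z ^ (α - 1) ∂(GaussFlow.sphereMeasure n))
      (Ico 0 T) t := by
  have h := hX.strictlyConvex t ht
  -- `radialProj 0` merely supplies some point of the sphere.
  refine ⟨h.bijective_normal hn, h.enclosedVolume_eq hn (GaussFlow.radialProj 0),
    h.enclosedVolume_eq_integral_normal hn (GaussFlow.radialProj 0), ?_⟩
  rw [h.integral_curvatureAtNormal_rpow hn]
  exact hX.hasDerivWithinAt_enclosedVolume hn ht
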